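/- \textbf{Model.} $n$ anonymous, oblivious robots are points of $\mathbb{R}^2$ and proceed in fully synchronous rounds. In each round every robot observes the multiset of positions of all robots in its own ego-centered coordinate system (orientation, chirality and unit of length are chosen by an adversary that knows the past and gives robots located at the same point the same system). From this observation alone the common algorithm computes a nonempty finite multiset $Pos$ of possible destinations; the robot moves to an element of $Pos$ chosen uniformly at random, independently of the other robots, which uses $\log|Pos|$ random bits; bits used by robots that are alone at their location are not counted ($\log=\log_2$). An algorithm uses \emph{only global weak multiplicity detection} if $Pos$ depends only on which points are occupied and which are occupied by more than one robot, and \emph{no multiplicity detection} if it depends only on which points are occupied. It is a \emph{scattering algorithm} if, for every $n$, every initial configuration and every adversary, with probability $1$ a configuration is reached in which no two robots share a location. Its time complexity and its random bit complexity are the expected number of rounds, respectively of random bits used, until such a configuration is first reached, in the worst case over initial configurations of $n$ robots and adversaries. \textbf{Algorithm.} Let $f(n)=\lfloor\log\log n\rfloor$ for $n\ge 2$ and $f(0)=f(1)=0$, and $f^{-1}(y)=\max\{x\in\mathbb{N} : f(x)=y\}$. Let $\mathcal{N}\in\mathbb{N}$ be such that for all $m>\mathcal{N}$ and $1\le k\le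 8m^3$, if $m$ robots choose independently and uniformly among $k$ destinations, then some destination is chosen by more than $\frac{m}{k}(1+k^{3/4})$ robots with probability at most $\frac{1}{2k}$. In $\mathcal{SA}_{\log\circ\log}$, a robot that observes $u$ occupied points sets $x=f^{-1}(f(u)+1)$ and $k=\max(8\mathcal{N}^3,16x^4,u^3)$ and takes for $Pos$ a set of $k$ distinct points in its (open) Voronoi cell with respect to the occupied points, computed without multiplicity detection. \textbf{Corollary.} Such an $\mathcal{N}$ exists. For every such $\mathcal{N}$, the algorithm $\mathcal{SA}_{\log\circ\log}$ can be implemented, and, however the points of $Pos$ are picked in the Voronoi cells, it is a scattering algorithm with time complexity $\Theta(\log\log n)$ and random bit complexity $\Theta(n\log n)$. It is optimal for both: every scattering algorithm (with any kind of multiplicity detection) has random bit complexity at least $n\log n$ for every $n$, and every scattering algorithm that uses only global weak multiplicity detection and is random bit optimal, i.e. has random bit complexity $O(n\log n)$, has time complexity $\Omega(\log\log n)$. -/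

import Mathlib

open Filter Topology
open scoped ENNReal

noncomputable section

namespace Scattering

/-- The Euclidean plane in which the robots live. -/
abbrev Plane : Type := EuclideanSpace ℝ (Fin 2)

/-- A configuration of `n` robots. The labels serve the analysis only: what a robot observes
(see `localSnapshot`) does not contain them. -/
abbrev Config (n : ℕ) : Type := Fin n → Plane

/-- No two robots share the same location. -/
def Scattered {n : ℕ} (C : Config n) : Prop := Function.Injective C

open Classical in
/-- The number of robots located at `P`. -/
def multiplicity {n : ℕ} (C : Config n) (P : Plane) : ℕ :=
  (Finset.univ.filter fun i => C i = P).card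

/-- The orientation, chirality and unit of length of a robot's ego-centered coordinate system;
its origin is the location of the robot. -/
structure Frame where
  iso : Plane ≃ₗᵢ[ℝ] Plane
  scale : ℝ
  scale_pos : 0 < scale

/-- The coordinates of `Q` in the frame of a robot located at `P`. -/
def Frame.toLocal (φ : Frame) (P Q : Plane) : Plane := φ.scale • φ.iso (Q - P)

/-- The point with coordinates `X` in the frame of a robot located at `P`. -/
def Frame.toGlobal (φ : Frame) (P X : Plane) : Plane := P + φ.scale⁻¹ • φ.iso.symm X

/-- The positions of all robots, with multiplicity, in the coordinates of a robot located at `P`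
(so that this robot itself is at `0`). -/
def localSnapshot {n : ℕ} (φ : Frame) (C : Config n) (P : Plane) : Multiset Plane :=
  Finset.univ.val.map fun i => φ.toLocal P (C i)

/-- An oblivious algorithm, common to all robots. Given the snapshot in its own coordinates, with
full multiplicity information, a robot computes a nonempty finite multiset of possible
destinations in its own coordinates, and then chooses one of them uniformly at random. Weaker
multiplicity detection is expressed by `GlobalWeakDetection` and `NoDetection`. -/
structure Algorithm where
  dest : Multiset Plane → Multiset Plane
  dest_ne_zero : ∀ S, dest S ≠ 0

open Classical in
/-- The algorithm uses at most global weak multiplicity detection: it may depend only on which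
points are occupied, and on which points are occupied by more than one robot. -/
def Algorithm.GlobalWeakDetection (A : Algorithm) : Prop :=
  ∀ S S' : Multiset Plane, (∀ Q, Q ∈ S ↔ Q ∈ S') →
    (∀ Q, 1 < S.count Q ↔ 1 < S'.count Q) → A.dest S = A.dest S'

/-- The algorithm uses no multiplicity detection: it may depend only on which points are
occupied. -/
def Algorithm.NoDetection (A : Algorithm) : Prop :=
  ∀ S S' : Multiset Plane, (∀ Q, Q ∈ S ↔ Q ∈ S') → A.dest S = A.dest S'

/-- The possible destinations, in global coordinates, of a robot located at `P`. -/
def Algorithm.destinations (A : Algorithm) {n : ℕ} (φ : Frame) (C : Config n) (P : Plane) :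
    Multiset Plane :=
  (A.dest (localSnapshot φ C P)).map (φ.toGlobal P)

theorem Algorithm.destinations_ne_zero (A : Algorithm) {n : ℕ} (φ : Frame) (C : Config n)
    (P : Plane) : A.destinations φ C P ≠ 0 := by
  simpa [Algorithm.destinations] using A.dest_ne_zero _

open Classical in
theorem Algorithm.nonempty_choices (A : Algorithm) {n : ℕ} (φ : Plane → Frame) (C : Config n) :
    Nonempty (∀ i : Fin n, (A.destinations (φ (C i)) C (C i)).ToType) := by
  refine ⟨fun i => Classical.choice ?_⟩
  obtain ⟨x, hx⟩ := Multiset.exists_mem_of_ne_zero (A.destinations_ne_zero (φ (C i)) C (C i))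
  exact ⟨⟨x, ⟨0, Multiset.count_pos.2 hx⟩⟩⟩

open Classical in
/-- One fully synchronous round. Robots located at the same point `P` share the frame `φ P`.
Every robot chooses one of its possible destinations, uniformly and independently of the others
(that is, the tuple of choices is uniform), and moves to it. -/
def Algorithm.step (A : Algorithm) {n : ℕ} (φ : Plane → Frame) (C : Config n) :
    PMF (Config n) :=
  haveI := A.nonempty_choices φ C
  (PMF.uniformOfFintype (∀ i : Fin n, (A.destinations (φ (C i)) C (C i)).ToType)).map
    fun c i => (c i).1

/-- A finite execution: the current configuration and the list of the earlier ones, most recent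
first. -/
abbrev History (n : ℕ) : Type := Config n × List (Config n)

/-- The adversary chooses, in each round and depending on the whole past, the coordinate systems
of the robots; robots located at the same point get the same one. -/
abbrev Adversary (n : ℕ) : Type := History n → Plane → Frame

/-- The law of the first `t` rounds of the execution that starts in `C₀`. -/
def Algorithm.execution (A : Algorithm) {n : ℕ} (adv : Adversary n) (C₀ : Config n) :
    ℕ → PMF (History n)
  | 0 => PMF.pure (C₀, [])
  | t + 1 => (A.execution adv C₀ t).bind fun h =>
      (A.step (adv h) h.1).map fun C => (C, h.1 :: h.2)

/-- No configuration met so far is scattered. -/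
def Unscattered {n : ℕ} (h : History n) : Prop :=
  ¬ Scattered h.1 ∧ ∀ C ∈ h.2, ¬ Scattered C

open Classical in
/-- The expectation, over all executions, of the sum of the weights of the rounds that are
performed until the first scattered configuration is reached. The round that follows the
history `h` has weight `w h`. -/
def Algorithm.expectedTotal (A : Algorithm) {n : ℕ} (adv : Adversary n) (C₀ : Config n)
    (w : History n → ℝ≥0∞) : ℝ≥0∞ :=
  ∑' t : ℕ, ∑' h : History n, A.execution adv C₀ t h * (if Unscattered h then w h else 0)

open Classical in
/-- The number of random bits used in one round: a robot that chooses among `k` possible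
destinations uses `log₂ k` bits, and only robots located at points of multiplicity count. -/
def Algorithm.roundBits (A : Algorithm) {n : ℕ} (φ : Plane → Frame) (C : Config n) : ℝ≥0∞ :=
  ∑ i : Fin n, if 2 ≤ multiplicity C (C i) then
    ENNReal.ofReal (Real.logb 2 (Multiset.card (A.destinations (φ (C i)) C (C i)))) else 0

/-- The time complexity: the expected number of rounds until `n` robots are scattered, in the
worst case over initial configurations and adversaries. -/
def Algorithm.rounds (A : Algorithm) (n : ℕ) : ℝ≥0∞ :=
  ⨆ (adv : Adversary n) (C₀ : Config n), A.expectedTotal adv C₀ fun _ => 1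

/-- The random bit complexity: the expected number of random bits used until `n` robots are
scattered, in the worst case over initial configurations and adversaries. -/
def Algorithm.bits (A : Algorithm) (n : ℕ) : ℝ≥0∞ :=
  ⨆ (adv : Adversary n) (C₀ : Config n),
    A.expectedTotal adv C₀ fun h => A.roundBits (adv h) h.1

open Classical in
/-- `A` is a scattering algorithm: from every initial configuration of any number of robots, and
against every adversary, a scattered configuration is reached with probability one. -/
def Algorithm.IsScattering (A : Algorithm) : Prop :=
  ∀ (n : ℕ) (adv : Adversary n) (C₀ : Config n),
    Tendsto (fun t : ℕ => ∑' h : History n,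
      A.execution adv C₀ t h * (if Unscattered h then 1 else 0)) atTop (𝓝 0)

/-- `F(n) = O(g(n))`. -/
def IsBigO (F : ℕ → ℝ≥0∞) (g : ℕ → ℝ) : Prop :=
  ∃ c : ℝ, 0 < c ∧ ∀ᶠ n in atTop, F n ≤ ENNReal.ofReal (c * g n)

/-- `F(n) = Ω(g(n))`. -/
def IsBigOmega (F : ℕ → ℝ≥0∞) (g : ℕ → ℝ) : Prop :=
  ∃ c : ℝ, 0 < c ∧ ∀ᶠ n in atTop, ENNReal.ofReal (c * g n) ≤ F n

/-- `F(n) = Θ(g(n))`. -/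
def IsBigTheta (F : ℕ → ℝ≥0∞) (g : ℕ → ℝ) : Prop := IsBigO F g ∧ IsBigOmega F g

/-- `log log n`, in base two. -/
def logLog (n : ℕ) : ℝ := Real.logb 2 (Real.logb 2 n)

/-- `n log n`, in base two. -/
def nLog (n : ℕ) : ℝ := n * Real.logb 2 n

/-- The open Voronoi cell of the site `P` among the sites `U`. -/
def voronoiCell (U : Set Plane) (P : Plane) : Set Plane :=
  {Q | ∀ P' ∈ U, P' ≠ P → dist Q P < dist Q P'}

/-- `f⁻¹(y) = max {x | f x = y}`, for `f` monotone and surjective. -/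
def maxInv (f : ℕ → ℕ) (y : ℕ) : ℕ := sSup {x | f x = y}

open Classical in
/-- When more than `N` robots choose independently and uniformly among `k ≤ 8 m ^ 3` destinations,
where `m` is the number of robots, some destination is chosen by more than
`(m / k) * (1 + k ^ (3 / 4))` robots with probability at most `1 / (2 k)`. -/
def IsThreshold (N : ℕ) : Prop :=
  ∀ m k : ℕ, N < m → 1 ≤ k → k ≤ 8 * m ^ 3 →
    ((Finset.univ.filter fun X : Fin m → Fin k =>
        ∃ j, (m : ℝ) / k * (1 + (k : ℝ) ^ (3 / 4 : ℝ)) <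
          ((Finset.univ.filter fun i => X i = j).card : ℝ)).card : ℝ) / (k : ℝ) ^ m
      ≤ 1 / (2 * k)

/-- The number of destinations that `SA_f` computes when it observes `u` occupied points. -/
def saCount (f : ℕ → ℕ) (N u : ℕ) : ℕ :=
  max (8 * N ^ 3) (max (16 * maxInv f (f u + 1) ^ 4) (u ^ 3))

open Classical in
/-- `A` is an implementation of `SA_f`: without multiplicity detection, a robot (at `0` in its own
coordinates) computes a set of `saCount f N u` distinct points in its Voronoi cell, where `u` is
the number of occupied points, and chooses among them. How the points are picked inside the cell
is left open. -/
structure Algorithm.IsSA (A : Algorithm) (f : ℕ → ℕ) (N : ℕ) : Prop where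
  noDetection : A.NoDetection
  nodup : ∀ S : Multiset Plane, 0 ∈ S → (A.dest S).Nodup
  card_dest : ∀ S : Multiset Plane, 0 ∈ S →
    Multiset.card (A.dest S) = saCount f N S.toFinset.card
  mem_cell : ∀ S : Multiset Plane, 0 ∈ S → ∀ Q ∈ A.dest S, Q ∈ voronoiCell {P | P ∈ S} 0

/-- The monotone surjection `⌊log₂ log₂ n⌋` of the natural numbers (`0` for `n < 4`). -/
def logLogNat (n : ℕ) : ℕ := Nat.log 2 (Nat.log 2 n)

end Scattering

end

/-
A tuple of choices of `m` robots with some destination chosen `r` times is covered by the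
`k * choose m r` events that `r` given robots choose a given destination. Since
`choose m r ≤ (e m / r) ^ r`, this union bound gives the threshold.

Bits: let the entropy of a configuration be the sum of `log₂ (multiplicity)` over the robots. By
Gibbs' inequality a round cannot decrease it by more than the number of bits used, it vanishes
on scattered configurations, and it equals `n log n` when all robots share a location.

Rounds: with weak detection, the choices are the same after adding robots at a point that
already has several. When about `u` robots are added to a configuration with `u` occupied
points, the bit bound forces the number of destinations to be polynomial in `u`. So one round
takes `u` to at most a power of `u`, and `n` points are reached only after `Ω(log log n)`
rounds.

The algorithm: robots at distinct points never meet, because Voronoi cells are disjoint. Fix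
`min n x` robots. The number of destinations is at least `16 x ^ 4`, so with probability at
least `1 / 2` the next destinations of these robots are distinct, which scatters the robots or
raises `f u`. Hence each of the `f n + 1` levels takes two rounds in expectation. A round at
level `y` costs `O(n 2 ^ y)` bits, and the geometric sum over the levels is `O(n log n)`.
-/

open scoped Finset

namespace Scattering

section BallsIntoBins

variable {ι κ : Type*} [Fintype ι] [Fintype κ]

open Classical in
theorem card_forall_mem_eq_mul_pow (s : Finset ι) (j : κ) :
    #{X : ι → κ | ∀ i ∈ s, X i = j} * Fintype.card κ ^ #s
      = Fintype.card κ ^ Fintype.card ι := by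
  have hpi : ({X : ι → κ | ∀ i ∈ s, X i = j} : Finset (ι → κ)) =
      Fintype.piFinset fun i => if i ∈ s then {j} else Finset.univ := by
    ext X
    simp only [Finset.mem_filter_univ, Fintype.mem_piFinset]
    refine forall_congr' fun i => ?_
    split_ifs with h <;> simp [h]
  have hcard : #{X : ι → κ | ∀ i ∈ s, X i = j} = Fintype.card κ ^ #sᶜ := by
    rw [hpi, Fintype.card_piFinset, ← Finset.prod_mul_prod_compl s,
      Finset.prod_eq_one fun i hi => by simp [hi], one_mul,
      Finset.prod_congr rfl fun i hi => by rw [if_neg (Finset.mem_compl.1 hi)],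
      Finset.prod_const, Finset.card_univ]
  rw [hcard, ← pow_add, Finset.card_compl_add_card]

open Classical in
theorem card_exists_le_card_fiber_mul_pow_le (r : ℕ) :
    #{X : ι → κ | ∃ j, r ≤ #{i | X i = j}} * Fintype.card κ ^ r
      ≤ Fintype.card κ * (Fintype.card ι).choose r * Fintype.card κ ^ Fintype.card ι := by
  have hcover : ({X : ι → κ | ∃ j, r ≤ #{i | X i = j}} : Finset (ι → κ)) ⊆
      (Finset.univ ×ˢ Finset.powersetCard r Finset.univ).biUnion fun p : κ × Finset ι =>
        {X | ∀ i ∈ p.2, X i = p.1} := by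
    intro X hX
    obtain ⟨j, hj⟩ := (Finset.mem_filter_univ X).1 hX
    obtain ⟨s, hs, rfl⟩ := Finset.exists_subset_card_eq hj
    refine Finset.mem_biUnion.2 ⟨(j, s), by simp, ?_⟩
    exact (Finset.mem_filter_univ X).2 fun i hi => (Finset.mem_filter_univ i).1 (hs hi)
  calc #{X : ι → κ | ∃ j, r ≤ #{i | X i = j}} * Fintype.card κ ^ r
      ≤ (∑ p ∈ Finset.univ ×ˢ Finset.powersetCard r Finset.univ,
          #{X : ι → κ | ∀ i ∈ p.2, X i = p.1}) * Fintype.card κ ^ r := by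
        gcongr
        exact (Finset.card_le_card hcover).trans Finset.card_biUnion_le
    _ = ∑ _p ∈ (Finset.univ : Finset κ) ×ˢ Finset.powersetCard r (Finset.univ : Finset ι),
          Fintype.card κ ^ Fintype.card ι := by
        rw [Finset.sum_mul]
        refine Finset.sum_congr rfl fun p hp => ?_
        rw [← card_forall_mem_eq_mul_pow p.2 p.1,
          (Finset.mem_powersetCard.1 (Finset.mem_product.1 hp).2).2]
    _ = Fintype.card κ * (Fintype.card ι).choose r * Fintype.card κ ^ Fintype.card ι := by
        simp

theorem choose_le_exp_one_mul_div_pow (m r : ℕ) :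
    (m.choose r : ℝ) ≤ (Real.exp 1 * m / r) ^ r := by
  rcases r.eq_zero_or_pos with rfl | hr
  · simp
  have hr' : (0 : ℝ) < r := mod_cast hr
  have hfactorial : (r : ℝ) ^ r ≤ Real.exp 1 ^ r * r.factorial := by
    have h := Real.pow_div_factorial_le_exp r hr'.le r
    rwa [← Real.exp_one_pow, div_le_iff₀ (by positivity)] at h
  calc (m.choose r : ℝ) ≤ (m : ℝ) ^ r / r.factorial := Nat.choose_le_pow_div r m
    _ ≤ (Real.exp 1 * m / r) ^ r := by
      rw [div_pow, mul_pow, div_le_div_iff₀ (by positivity) (by positivity)]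
      calc (m : ℝ) ^ r * (r : ℝ) ^ r ≤ (m : ℝ) ^ r * (Real.exp 1 ^ r * r.factorial) := by gcongr
        _ = Real.exp 1 ^ r * (m : ℝ) ^ r * r.factorial := by ring

open Classical in
theorem card_exists_le_card_fiber_div_pow_le [Nonempty κ] (r : ℕ) :
    (#{X : ι → κ | ∃ j, r ≤ #{i | X i = j}} : ℝ) / (Fintype.card κ : ℝ) ^ Fintype.card ι
      ≤ Fintype.card κ * (Real.exp 1 * Fintype.card ι / (r * Fintype.card κ)) ^ r := by
  have : (0 : ℝ) < Fintype.card κ := mod_cast Fintype.card_pos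
  have hcount : (#{X : ι → κ | ∃ j, r ≤ #{i | X i = j}} : ℝ) * (Fintype.card κ : ℝ) ^ r
      ≤ Fintype.card κ * (Fintype.card ι).choose r * (Fintype.card κ : ℝ) ^ Fintype.card ι :=
    mod_cast card_exists_le_card_fiber_mul_pow_le r
  calc (#{X : ι → κ | ∃ j, r ≤ #{i | X i = j}} : ℝ) / (Fintype.card κ : ℝ) ^ Fintype.card ι
      ≤ Fintype.card κ * (Fintype.card ι).choose r / (Fintype.card κ : ℝ) ^ r := by
        rwa [div_le_div_iff₀ (by positivity) (by positivity)]
    _ ≤ Fintype.card κ * (Real.exp 1 * Fintype.card ι / r) ^ r / (Fintype.card κ : ℝ) ^ r := by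
        gcongr
        exact choose_le_exp_one_mul_div_pow _ _
    _ = Fintype.card κ * (Real.exp 1 * Fintype.card ι / (r * Fintype.card κ)) ^ r := by
        rw [mul_div_assoc, ← div_pow, div_div]

theorem exp_one_mul_rpow_eighth_le {x : ℝ} (hx : 4 ≤ x) :
    Real.exp 1 * x ^ (1 / 8 : ℝ) ≤ 1 + x ^ (3 / 4 : ℝ) := by
  have hx0 : 0 ≤ x := by linarith
  have hpow (k : ℕ) : (x ^ (1 / 8 : ℝ)) ^ k = x ^ (k / 8 : ℝ) := by
    rw [← Real.rpow_mul_natCast hx0]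
    ring_nf
  set s : ℝ := x ^ (1 / 8 : ℝ)
  have hsix : s ^ 6 = x ^ (3 / 4 : ℝ) := by rw [hpow]; norm_num
  have height : s ^ 8 = x := by rw [hpow]; norm_num
  have hfour : 2 ≤ s ^ 4 := by nlinarith [sq_nonneg (s ^ 2)]
  have : 0 ≤ s := by positivity
  calc Real.exp 1 * s ≤ 2.8 * s := by gcongr; linarith [Real.exp_one_lt_d9]
    _ ≤ 1 + 2 * s ^ 2 := by nlinarith [sq_nonneg (s - 0.7)]
    _ ≤ 1 + s ^ 4 * s ^ 2 := by gcongr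
    _ = 1 + x ^ (3 / 4 : ℝ) := by rw [← hsix]; ring

theorem le_one_add_rpow_three_quarters {k : ℕ} (hk0 : 1 ≤ k) (hk : k < 4) :
    (k : ℝ) ≤ 1 + (k : ℝ) ^ (3 / 4 : ℝ) := by
  rw [← sub_le_iff_le_add']
  refine le_of_pow_le_pow_left₀ four_ne_zero (by positivity) ?_
  rw [← Real.rpow_mul_natCast k.cast_nonneg]
  interval_cases k <;> norm_num

theorem twenty_four_le_overload {m k : ℕ} (hm : 8 * 24 ^ 4 ≤ m) (hk : 1 ≤ k)
    (hkm : k ≤ 8 * m ^ 3) :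
    24 ≤ (m : ℝ) / k * (1 + (k : ℝ) ^ (3 / 4 : ℝ)) := by
  have hk0 : (0 : ℝ) < k := mod_cast hk
  have hm' : (8 * 24 ^ 4 : ℝ) ≤ m := mod_cast hm
  have hkm' : (k : ℝ) ≤ 8 * (m : ℝ) ^ 3 := mod_cast hkm
  have hpow : (24 * k : ℝ) ≤ m * (k : ℝ) ^ (3 / 4 : ℝ) := by
    refine le_of_pow_le_pow_left₀ four_ne_zero (by positivity) ?_
    rw [mul_pow, mul_pow, ← Real.rpow_mul_natCast hk0.le]
    norm_num only [Nat.cast_ofNat, Real.rpow_ofNat]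
    calc (331776 : ℝ) * (k : ℝ) ^ 4 = 331776 * k * (k : ℝ) ^ 3 := by ring
      _ ≤ 331776 * (8 * (m : ℝ) ^ 3) * (k : ℝ) ^ 3 := by gcongr
      _ = 8 * 24 ^ 4 * (m : ℝ) ^ 3 * (k : ℝ) ^ 3 := by ring
      _ ≤ m * (m : ℝ) ^ 3 * (k : ℝ) ^ 3 := by gcongr
      _ = (m : ℝ) ^ 4 * (k : ℝ) ^ 3 := by ring
  rw [div_mul_eq_mul_div, le_div_iff₀ hk0]
  linarith

theorem mul_exp_one_mul_div_pow_le {m k r : ℕ} (hk : 4 ≤ k) (hr24 : 24 ≤ r)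
    (hr : (m : ℝ) / k * (1 + (k : ℝ) ^ (3 / 4 : ℝ)) ≤ r) :
    k * (Real.exp 1 * m / (r * k)) ^ r ≤ 1 / (2 * k) := by
  have hk4 : (4 : ℝ) ≤ k := mod_cast hk
  have hk0 : (0 : ℝ) < k := by linarith
  have : (0 : ℝ) < r := mod_cast (by omega : 0 < r)
  have hbase : Real.exp 1 * m / (r * k) ≤ (k : ℝ) ^ (-(1 / 8) : ℝ) := by
    rw [Real.rpow_neg hk0.le, ← one_div, div_le_div_iff₀ (by positivity) (by positivity), one_mul]
    calc Real.exp 1 * m * (k : ℝ) ^ (1 / 8 : ℝ)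
        = m * (Real.exp 1 * (k : ℝ) ^ (1 / 8 : ℝ)) := by ring
      _ ≤ m * (1 + (k : ℝ) ^ (3 / 4 : ℝ)) := by gcongr; exact exp_one_mul_rpow_eighth_le hk4
      _ ≤ r * k := by rwa [← div_le_iff₀ hk0, ← div_mul_eq_mul_div]
  have hbase_le_one : (k : ℝ) ^ (-(1 / 8) : ℝ) ≤ 1 :=
    Real.rpow_le_one_of_one_le_of_nonpos (by linarith) (by norm_num)
  calc k * (Real.exp 1 * m / (r * k)) ^ r
      ≤ k * ((k : ℝ) ^ (-(1 / 8) : ℝ)) ^ r := by gcongr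
    _ ≤ k * ((k : ℝ) ^ (-(1 / 8) : ℝ)) ^ 24 := by
        gcongr k * ?_
        exact pow_le_pow_of_le_one (by positivity) hbase_le_one hr24
    _ = 1 / (k : ℝ) ^ 2 := by
        rw [← Real.rpow_mul_natCast hk0.le]
        norm_num [Real.rpow_neg hk0.le]
        field_simp
    _ ≤ 1 / (2 * k) := by
        rw [sq]
        gcongr
        linarith

theorem isThreshold_eight_mul_twenty_four_pow : IsThreshold (8 * 24 ^ 4) := by
  classical
  intro m k hm hk hkm
  set θ : ℝ := (m : ℝ) / k * (1 + (k : ℝ) ^ (3 / 4 : ℝ)) with hθ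
  rcases lt_or_ge k 4 with hk4 | hk4
  · have hmθ : (m : ℝ) ≤ θ := by
      rw [hθ, div_mul_eq_mul_div, le_div_iff₀ (mod_cast hk)]
      gcongr
      exact le_one_add_rpow_three_quarters hk hk4
    rw [Finset.filter_false_of_mem, Finset.card_empty, Nat.cast_zero, zero_div]
    · positivity
    rintro X - ⟨j, hj⟩
    have hbin : (#{i | X i = j} : ℝ) ≤ m := by
      exact_mod_cast (Finset.card_le_univ _).trans_eq (Fintype.card_fin m)
    linarith
  have : Nonempty (Fin k) := ⟨⟨0, hk⟩⟩
  have hθ24 : (24 : ℝ) ≤ ⌈θ⌉₊ :=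
    (twenty_four_le_overload hm.le hk hkm).trans (Nat.le_ceil θ)
  calc _ ≤ (#{X : Fin m → Fin k | ∃ j, ⌈θ⌉₊ ≤ #{i | X i = j}} : ℝ) / (k : ℝ) ^ m := by
        gcongr with X _ j
        exact fun h => Nat.ceil_le.2 h.le
    _ ≤ k * (Real.exp 1 * m / (⌈θ⌉₊ * k)) ^ ⌈θ⌉₊ := by
        convert card_exists_le_card_fiber_div_pow_le (ι := Fin m) (κ := Fin k) ⌈θ⌉₊ <;> simp
    _ ≤ 1 / (2 * k) := mul_exp_one_mul_div_pow_le hk4 (mod_cast hθ24) (Nat.le_ceil θ)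

end BallsIntoBins

section Mean

variable {α β : Type*}

/-- The expectation of `F` under `p`. It takes values in `ℝ≥0∞`, so that no integrability condition
is needed. -/
noncomputable def mean (p : PMF α) (F : α → ℝ≥0∞) : ℝ≥0∞ := ∑' a, p a * F a

theorem mean_mono {p : PMF α} {F G : α → ℝ≥0∞} (h : ∀ a ∈ p.support, F a ≤ G a) :
    mean p F ≤ mean p G := by
  refine ENNReal.tsum_le_tsum fun a => ?_
  by_cases ha : p a = 0
  · simp [ha]
  · exact mul_le_mul_right (h a ((p.mem_support_iff a).2 ha)) _

theorem mean_congr {p : PMF α} {F G : α → ℝ≥0∞} (h : ∀ a ∈ p.support, F a = G a) :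
    mean p F = mean p G :=
  (mean_mono fun a ha => (h a ha).le).antisymm (mean_mono fun a ha => (h a ha).ge)

theorem mean_add (p : PMF α) (F G : α → ℝ≥0∞) :
    mean p (fun a => F a + G a) = mean p F + mean p G := by
  simp only [mean, mul_add, ENNReal.tsum_add]

theorem mean_const (p : PMF α) (c : ℝ≥0∞) : mean p (fun _ => c) = c := by
  rw [mean, ENNReal.tsum_mul_right, p.tsum_coe, one_mul]

theorem mean_const_mul (p : PMF α) (c : ℝ≥0∞) (F : α → ℝ≥0∞) :
    mean p (fun a => c * F a) = c * mean p F := by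
  simp only [mean, mul_left_comm _ c, ENNReal.tsum_mul_left]

theorem mean_indicator_const (p : PMF α) (s : Set α) (c : ℝ≥0∞) :
    mean p (s.indicator fun _ => c) = c * p.toOuterMeasure s := by
  rw [PMF.toOuterMeasure_apply, mean, ← ENNReal.tsum_mul_left]
  refine tsum_congr fun a => ?_
  by_cases ha : a ∈ s <;> simp [ha, mul_comm]

theorem mean_pure (a : α) (F : α → ℝ≥0∞) : mean (PMF.pure a) F = F a := by
  rw [mean, tsum_eq_single a fun b hb => by rw [PMF.pure_apply_of_ne _ _ hb, zero_mul],
    PMF.pure_apply_self, one_mul]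

theorem mean_bind (p : PMF α) (q : α → PMF β) (F : β → ℝ≥0∞) :
    mean (p.bind q) F = mean p fun a => mean (q a) F := by
  simp only [mean, PMF.bind_apply, ← ENNReal.tsum_mul_right, ← ENNReal.tsum_mul_left, mul_assoc]
  exact ENNReal.tsum_comm

theorem mean_map (p : PMF α) (g : α → β) (F : β → ℝ≥0∞) :
    mean (p.map g) F = mean p (F ∘ g) := by
  simp only [PMF.map, mean_bind, Function.comp_def, mean_pure]

end Mean

section Execution

variable {n : ℕ} {A : Algorithm} {adv : Adversary n} {C₀ : Config n}

theorem unscattered_cons {C : Config n} {h : History n} :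
    Unscattered (C, h.1 :: h.2) ↔ ¬ Scattered C ∧ Unscattered h := by
  simp [Unscattered]

open Classical in
/-- The expected weight of the round that follows the first `t` rounds, which counts only if no
scattered configuration has been met. -/
noncomputable def Algorithm.meanUnscattered (A : Algorithm) (adv : Adversary n) (C₀ : Config n)
    (t : ℕ) (w : History n → ℝ≥0∞) : ℝ≥0∞ :=
  mean (A.execution adv C₀ t) fun h => if Unscattered h then w h else 0

theorem expectedTotal_eq_tsum (w : History n → ℝ≥0∞) :
    A.expectedTotal adv C₀ w = ∑' t, A.meanUnscattered adv C₀ t w := rfl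

theorem meanUnscattered_zero (hC₀ : ¬ Scattered C₀) (w : History n → ℝ≥0∞) :
    A.meanUnscattered adv C₀ 0 w = w (C₀, []) := by
  simp [Algorithm.meanUnscattered, Algorithm.execution, mean_pure, Unscattered, hC₀]

theorem meanUnscattered_zero_of_scattered (hC₀ : Scattered C₀) (w : History n → ℝ≥0∞) :
    A.meanUnscattered adv C₀ 0 w = 0 := by
  simp [Algorithm.meanUnscattered, Algorithm.execution, mean_pure, Unscattered, hC₀]

theorem meanUnscattered_succ (t : ℕ) (w : History n → ℝ≥0∞) :
    A.meanUnscattered adv C₀ (t + 1) w = A.meanUnscattered adv C₀ t fun h =>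
      mean (A.step (adv h) h.1) ({C | ¬ Scattered C}.indicator fun C => w (C, h.1 :: h.2)) := by
  rw [Algorithm.meanUnscattered, Algorithm.execution, mean_bind]
  refine mean_congr fun h _ => ?_
  rw [mean_map]
  by_cases hh : Unscattered h
  · rw [if_pos hh]
    refine mean_congr fun C _ => ?_
    by_cases hC : Scattered C <;> simp [unscattered_cons, hh, hC]
  · simp [unscattered_cons, hh, Function.comp_def, mean_const]

theorem meanUnscattered_mono {t : ℕ} {w w' : History n → ℝ≥0∞}
    (h : ∀ h : History n, ¬ Scattered h.1 → w h ≤ w' h) :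
    A.meanUnscattered adv C₀ t w ≤ A.meanUnscattered adv C₀ t w' := by
  refine mean_mono fun g _ => ?_
  split_ifs with hg
  · exact h g hg.1
  · exact le_rfl

theorem meanUnscattered_add (t : ℕ) (w w' : History n → ℝ≥0∞) :
    A.meanUnscattered adv C₀ t (fun h => w h + w' h) =
      A.meanUnscattered adv C₀ t w + A.meanUnscattered adv C₀ t w' := by
  simp only [Algorithm.meanUnscattered, ← mean_add]
  refine mean_congr fun h _ => ?_
  split_ifs <;> simp

theorem meanUnscattered_const_mul (t : ℕ) (c : ℝ≥0∞) (w : History n → ℝ≥0∞) :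
    A.meanUnscattered adv C₀ t (fun h => c * w h) = c * A.meanUnscattered adv C₀ t w := by
  simp only [Algorithm.meanUnscattered, ← mean_const_mul, mul_ite, mul_zero]

theorem expectedTotal_le_of_supermartingale {w : History n → ℝ≥0∞} {V : Config n → ℝ≥0∞}
    (hV : ∀ h : History n, ¬ Scattered h.1 → w h + mean (A.step (adv h) h.1) V ≤ V h.1) :
    A.expectedTotal adv C₀ w ≤ V C₀ := by
  have hpartial (T : ℕ) : ∑ t ∈ Finset.range T, A.meanUnscattered adv C₀ t w
      + A.meanUnscattered adv C₀ T (fun h => V h.1) ≤ V C₀ := by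
    induction T with
    | zero =>
      by_cases hC₀ : Scattered C₀
      · simp [meanUnscattered_zero_of_scattered hC₀]
      · simp [meanUnscattered_zero hC₀]
    | succ T ih =>
      refine le_trans ?_ ih
      rw [Finset.sum_range_succ, add_assoc, meanUnscattered_succ, ← meanUnscattered_add]
      gcongr
      refine meanUnscattered_mono fun h hh => le_trans ?_ (hV h hh)
      gcongr
      exact mean_mono fun C _ => Set.indicator_le_self' (fun _ _ => zero_le) C
  rw [expectedTotal_eq_tsum, ENNReal.tsum_eq_iSup_nat]
  exact iSup_le fun T => le_self_add.trans (hpartial T)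

theorem Algorithm.IsScattering.tendsto_meanUnscattered_one (hA : A.IsScattering)
    (adv : Adversary n) (C₀ : Config n) :
    Tendsto (fun t => A.meanUnscattered adv C₀ t fun _ => 1) atTop (𝓝 0) :=
  hA n adv C₀

theorem le_expectedTotal_of_submartingale (hA : A.IsScattering) {w : History n → ℝ≥0∞}
    {V : Config n → ℝ≥0∞} {b : ℝ≥0∞} (hb : b ≠ ⊤) (hVb : ∀ C, V C ≤ b)
    (hV0 : ∀ C, Scattered C → V C = 0)
    (hV : ∀ h : History n, ¬ Scattered h.1 → V h.1 ≤ w h + mean (A.step (adv h) h.1) V) :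
    V C₀ ≤ A.expectedTotal adv C₀ w := by
  have hpartial (T : ℕ) : V C₀ ≤ ∑ t ∈ Finset.range T, A.meanUnscattered adv C₀ t w
      + A.meanUnscattered adv C₀ T (fun h => V h.1) := by
    induction T with
    | zero =>
      by_cases hC₀ : Scattered C₀
      · simp [hV0 C₀ hC₀]
      · simp [meanUnscattered_zero hC₀]
    | succ T ih =>
      refine ih.trans ?_
      rw [Finset.sum_range_succ, add_assoc, meanUnscattered_succ, ← meanUnscattered_add]
      gcongr
      refine meanUnscattered_mono fun h hh => (hV h hh).trans ?_
      gcongr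
      refine mean_mono fun C _ => ?_
      by_cases hC : Scattered C <;> simp [hC, hV0]
  have hlim : Tendsto (fun T => A.expectedTotal adv C₀ w +
      b * A.meanUnscattered adv C₀ T fun _ => 1) atTop (𝓝 (A.expectedTotal adv C₀ w)) := by
    simpa using tendsto_const_nhds.add
      (ENNReal.Tendsto.const_mul (hA.tendsto_meanUnscattered_one adv C₀) (Or.inr hb))
  refine ge_of_tendsto' hlim fun T => (hpartial T).trans ?_
  rw [← meanUnscattered_const_mul]
  gcongr
  · exact ENNReal.sum_le_tsum _
  · exact meanUnscattered_mono fun h _ => by simpa using hVb h.1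

theorem le_expectedTotal_first_round (hC₀ : ¬ Scattered C₀) (w : History n → ℝ≥0∞) :
    w (C₀, []) ≤ A.expectedTotal adv C₀ w := by
  rw [← meanUnscattered_zero (A := A) (adv := adv) hC₀ w]
  exact ENNReal.le_tsum 0

theorem expectedTotal_le_rounds (A : Algorithm) (adv : Adversary n) (C₀ : Config n) :
    A.expectedTotal adv C₀ (fun _ => 1) ≤ A.rounds n :=
  le_iSup₂ (f := fun adv C₀ => A.expectedTotal adv C₀ fun _ => 1) adv C₀

theorem expectedTotal_le_bits (A : Algorithm) (adv : Adversary n) (C₀ : Config n) :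
    A.expectedTotal adv C₀ (fun h => A.roundBits (adv h) h.1) ≤ A.bits n :=
  le_iSup₂ (f := fun adv C₀ => A.expectedTotal adv C₀ fun h => A.roundBits (adv h) h.1) adv C₀

theorem le_rounds_of_unscattered {T : ℕ}
    (hT : ∀ t < T, ∀ h ∈ (A.execution adv C₀ t).support, Unscattered h) :
    (T : ℝ≥0∞) ≤ A.rounds n := by
  have hone : ∀ t ∈ Finset.range T, A.meanUnscattered adv C₀ t (fun _ => 1) = 1 := fun t ht =>
    (mean_congr fun h hh => if_pos (hT t (Finset.mem_range.1 ht) h hh)).trans (mean_const _ 1)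
  calc (T : ℝ≥0∞) = ∑ t ∈ Finset.range T, A.meanUnscattered adv C₀ t fun _ => 1 := by
        simp [Finset.sum_congr rfl hone]
    _ ≤ A.expectedTotal adv C₀ fun _ => 1 := ENNReal.sum_le_tsum _
    _ ≤ A.rounds n := expectedTotal_le_rounds A adv C₀

theorem isScattering_of_rounds_ne_top (hA : ∀ n, A.rounds n ≠ ⊤) : A.IsScattering := by
  intro n adv C₀
  exact ENNReal.tendsto_atTop_zero_of_tsum_ne_top
    (ne_top_of_le_ne_top (hA n) (expectedTotal_le_rounds A adv C₀))

end Execution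

section OccupiedPoints

variable {n : ℕ}

/-- The set of occupied points. -/
noncomputable def occ (C : Config n) : Finset Plane := Finset.univ.image C

theorem mem_occ {C : Config n} {P : Plane} : P ∈ occ C ↔ ∃ i, C i = P := by
  simp [occ]

theorem apply_mem_occ (C : Config n) (i : Fin n) : C i ∈ occ C :=
  mem_occ.2 ⟨i, rfl⟩

theorem card_occ_le (C : Config n) : #(occ C) ≤ n :=
  Finset.card_image_le.trans_eq (Finset.card_fin n)

theorem scattered_iff_card_occ_eq {C : Config n} : Scattered C ↔ #(occ C) = n := by
  have h := Finset.card_image_iff (s := Finset.univ) (f := C)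
  rw [Finset.card_fin, Finset.coe_univ, Set.injOn_univ] at h
  exact h.symm

theorem card_occ_pos (hn : 0 < n) (C : Config n) : 0 < #(occ C) :=
  Finset.card_pos.2 ⟨_, apply_mem_occ C ⟨0, hn⟩⟩

theorem multiplicity_eq_card_filter (C : Config n) (P : Plane) :
    multiplicity C P = #{i | C i = P} := by
  rfl

theorem multiplicity_pos_iff {C : Config n} {P : Plane} : 0 < multiplicity C P ↔ P ∈ occ C := by
  rw [multiplicity_eq_card_filter, Finset.card_pos, mem_occ]
  exact Finset.filter_nonempty_iff.trans (by simp)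

theorem multiplicity_apply_pos (C : Config n) (i : Fin n) : 0 < multiplicity C (C i) :=
  multiplicity_pos_iff.2 (apply_mem_occ C i)

theorem multiplicity_le (C : Config n) (P : Plane) : multiplicity C P ≤ n :=
  (Finset.card_le_univ _).trans_eq (Fintype.card_fin n)

theorem Scattered.multiplicity_le_one {C : Config n} (hC : Scattered C) (P : Plane) :
    multiplicity C P ≤ 1 :=
  Finset.card_le_one.2 fun i hi j hj => hC <|
    ((Finset.mem_filter_univ i).1 hi).trans ((Finset.mem_filter_univ j).1 hj).symm

end OccupiedPoints

section Frames

noncomputable instance : Inhabited Frame := ⟨⟨LinearIsometryEquiv.refl ℝ Plane, 1, one_pos⟩⟩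

namespace Frame

variable (φ : Frame) (P : Plane)

theorem toGlobal_toLocal (Q : Plane) : φ.toGlobal P (φ.toLocal P Q) = Q := by
  simp [toGlobal, toLocal, smul_smul, inv_mul_cancel₀ φ.scale_pos.ne']

theorem toLocal_toGlobal (X : Plane) : φ.toLocal P (φ.toGlobal P X) = X := by
  simp [toGlobal, toLocal, smul_smul, mul_inv_cancel₀ φ.scale_pos.ne']

theorem toLocal_injective : Function.Injective (φ.toLocal P) :=
  Function.LeftInverse.injective (φ.toGlobal_toLocal P)

theorem toGlobal_injective : Function.Injective (φ.toGlobal P) :=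
  Function.LeftInverse.injective (φ.toLocal_toGlobal P)

variable {φ P} in
theorem toLocal_eq_iff {Q X : Plane} : φ.toLocal P Q = X ↔ Q = φ.toGlobal P X :=
  ⟨fun h => h ▸ (φ.toGlobal_toLocal P Q).symm, fun h => h ▸ φ.toLocal_toGlobal P X⟩

theorem toLocal_self : φ.toLocal P P = 0 := by
  simp [toLocal]

theorem dist_toLocal (Q R : Plane) :
    dist (φ.toLocal P Q) (φ.toLocal P R) = φ.scale * dist Q R := by
  rw [toLocal, toLocal, dist_smul₀, φ.iso.dist_map, dist_sub_right, Real.norm_of_nonneg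
    φ.scale_pos.le]

end Frame

variable {n : ℕ} {φ : Frame} {C : Config n} {P : Plane}

theorem mem_localSnapshot {X : Plane} :
    X ∈ localSnapshot φ C P ↔ φ.toGlobal P X ∈ occ C := by
  simp [localSnapshot, mem_occ, Frame.toLocal_eq_iff]

theorem count_localSnapshot (X : Plane) :
    (localSnapshot φ C P).count X = multiplicity C (φ.toGlobal P X) := by
  simp only [localSnapshot, Multiset.count_map, eq_comm (a := X), Frame.toLocal_eq_iff]
  rfl

theorem zero_mem_localSnapshot (hP : P ∈ occ C) : 0 ∈ localSnapshot φ C P := by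
  rwa [mem_localSnapshot, ← φ.toLocal_self P, φ.toGlobal_toLocal]

theorem card_toFinset_localSnapshot : #(localSnapshot φ C P).toFinset = #(occ C) := by
  have himage : (localSnapshot φ C P).toFinset = (occ C).image (φ.toLocal P) := by
    ext X
    simp [mem_localSnapshot, Frame.toLocal_eq_iff]
  rw [himage, Finset.card_image_of_injective _ (φ.toLocal_injective P)]

end Frames

section Destinations

variable {n : ℕ} {A : Algorithm}

theorem card_destinations (A : Algorithm) (φ : Frame) (C : Config n) (P : Plane) :
    (A.destinations φ C P).card = (A.dest (localSnapshot φ C P)).card :=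
  Multiset.card_map _ _

theorem card_destinations_pos (A : Algorithm) (φ : Frame) (C : Config n) (P : Plane) :
    0 < (A.destinations φ C P).card :=
  Multiset.card_pos.2 (A.destinations_ne_zero φ C P)

theorem logb_card_destinations_nonneg (A : Algorithm) (φ : Frame) (C : Config n) (P : Plane) :
    0 ≤ Real.logb 2 (A.destinations φ C P).card :=
  Real.logb_nonneg one_lt_two (mod_cast card_destinations_pos A φ C P)

variable {φ : Plane → Frame} {C D : Config n}

theorem mem_destinations_of_mem_support_step (hD : D ∈ (A.step φ C).support) (i : Fin n) :
    D i ∈ A.destinations (φ (C i)) C (C i) := by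
  obtain ⟨c, -, rfl⟩ := (PMF.mem_support_map_iff _ _ _).1 hD
  exact Multiset.coe_mem

theorem card_image_filter_eq_le_card_destinations (hD : D ∈ (A.step φ C).support) (P : Plane) :
    #(Finset.image D {i | C i = P}) ≤ (A.destinations (φ P) C P).card := by
  refine le_trans (Finset.card_le_card fun Q hQ => ?_) (Multiset.toFinset_card_le _)
  obtain ⟨i, hi, rfl⟩ := Finset.mem_image.1 hQ
  obtain rfl := (Finset.mem_filter_univ i).1 hi
  exact Multiset.mem_toFinset.2 (mem_destinations_of_mem_support_step hD i)

end Destinations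

section RandomBitLowerBound

section Fibers

variable {ι κ : Type*} [DecidableEq κ] (G : Finset ι) (g : ι → κ)

theorem sum_inv_card_fiber : ∑ i ∈ G, (#{j ∈ G | g j = g i} : ℝ)⁻¹ = #(G.image g) := by
  rw [Finset.sum_comp (fun P => (#{j ∈ G | g j = P} : ℝ)⁻¹) g, Finset.cast_card]
  refine Finset.sum_congr rfl fun P hP => ?_
  have hfiber : #{j ∈ G | g j = P} ≠ 0 := Finset.card_ne_zero.2 <| by
    simpa [Finset.Nonempty] using hP
  rw [nsmul_eq_mul, mul_inv_cancel₀ (Nat.cast_ne_zero.2 hfiber)]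

-- Gibbs' inequality for the partition of `G` into fibers, from `log x ≤ x - 1`.
theorem card_mul_logb_card_le {b : ℝ} (hb : 1 < b) :
    #G * Real.logb b #G ≤
      #G * Real.logb b #(G.image g) + ∑ i ∈ G, Real.logb b #{j ∈ G | g j = g i} := by
  rcases G.eq_empty_or_nonempty with rfl | hG
  · simp
  have hGpos : (0 : ℝ) < #G := mod_cast hG.card_pos
  have hIpos : (0 : ℝ) < #(G.image g) := mod_cast (hG.image g).card_pos
  have hterm : ∀ i ∈ G, Real.log #G - Real.log #(G.image g) - Real.log #{j ∈ G | g j = g i} ≤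
      #G / #(G.image g) * (#{j ∈ G | g j = g i} : ℝ)⁻¹ - 1 := fun i hi => by
    have hFpos : (0 : ℝ) < #{j ∈ G | g j = g i} :=
      mod_cast Finset.card_pos.2 ⟨i, Finset.mem_filter.2 ⟨hi, rfl⟩⟩
    rw [← Real.log_div hGpos.ne' hIpos.ne', ← Real.log_div (by positivity) hFpos.ne',
      ← div_eq_mul_inv]
    exact Real.log_le_sub_one_of_pos (by positivity)
  have hsum := Finset.sum_le_sum hterm
  simp only [Finset.sum_sub_distrib, ← Finset.mul_sum, sum_inv_card_fiber, Finset.sum_const,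
    nsmul_eq_mul, mul_one, div_mul_cancel₀ _ hIpos.ne', sub_self] at hsum
  simp only [Real.logb, ← Finset.sum_div, ← mul_div_assoc, ← add_div]
  exact div_le_div_of_nonneg_right (by linarith) (Real.log_pos hb).le

end Fibers

variable {n : ℕ}

/-- The number of random bits that are needed to scatter a configuration: `log₂ m` for each robot
at a point of multiplicity `m`. -/
noncomputable def entropy (C : Config n) : ℝ≥0∞ :=
  ∑ i, ENNReal.ofReal (Real.logb 2 (multiplicity C (C i)))

theorem entropy_le_nLog (C : Config n) : entropy C ≤ ENNReal.ofReal (nLog n) := by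
  calc entropy C ≤ ∑ _i : Fin n, ENNReal.ofReal (Real.logb 2 n) := by
        refine Finset.sum_le_sum fun i _ => ENNReal.ofReal_le_ofReal ?_
        exact Real.logb_le_logb_of_le one_lt_two (mod_cast multiplicity_apply_pos C i)
          (mod_cast multiplicity_le C (C i))
    _ = ENNReal.ofReal (nLog n) := by
        rw [nLog, ENNReal.ofReal_mul n.cast_nonneg]
        simp

theorem entropy_const (P : Plane) : entropy (fun _ : Fin n => P) = ENNReal.ofReal (nLog n) := by
  rw [nLog, ENNReal.ofReal_mul n.cast_nonneg]
  simp [entropy, multiplicity_eq_card_filter]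

theorem Scattered.entropy_eq_zero {C : Config n} (hC : Scattered C) : entropy C = 0 := by
  refine Finset.sum_eq_zero fun i _ => ?_
  rw [(hC.multiplicity_le_one _).antisymm (multiplicity_apply_pos C i)]
  simp

variable {A : Algorithm} {φ : Plane → Frame} {C D : Config n}

theorem multiplicity_mul_logb_le (hD : D ∈ (A.step φ C).support) (P : Plane) :
    multiplicity C P * Real.logb 2 (multiplicity C P) ≤
      multiplicity C P * Real.logb 2 (A.destinations (φ P) C P).card +
        ∑ i with C i = P, Real.logb 2 (multiplicity D (D i)) := by
  rcases (multiplicity C P).eq_zero_or_pos with hP | hP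
  · rw [multiplicity_eq_card_filter, Finset.card_eq_zero] at hP
    simp [multiplicity_eq_card_filter, hP]
  refine (card_mul_logb_card_le {i | C i = P} D one_lt_two).trans ?_
  rw [← multiplicity_eq_card_filter]
  gcongr with i hi
  · exact one_lt_two
  · exact Nat.cast_pos.2 ((Finset.card_pos.1 hP).image D).card_pos
  · exact card_image_filter_eq_le_card_destinations hD P
  · exact one_lt_two
  · exact Nat.cast_pos.2 (Finset.card_pos.2 ⟨i, Finset.mem_filter.2 ⟨hi, rfl⟩⟩)
  · exact Finset.card_le_card (Finset.filter_subset_filter _ (Finset.subset_univ _))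

theorem entropy_le_roundBits_add_entropy (hD : D ∈ (A.step φ C).support) :
    entropy C ≤ A.roundBits φ C + entropy D := by
  rw [entropy, Algorithm.roundBits, entropy, ← Finset.sum_add_distrib,
    ← Finset.sum_fiberwise_of_maps_to fun i _ => apply_mem_occ C i,
    ← Finset.sum_fiberwise_of_maps_to fun i _ => apply_mem_occ C i]
  refine Finset.sum_le_sum fun P _ => ?_
  rcases lt_or_ge (multiplicity C P) 2 with hP | hP
  · refine (Finset.sum_eq_zero fun i hi => ?_).trans_le zero_le
    rw [(Finset.mem_filter_univ i).1 hi]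
    interval_cases multiplicity C P <;> simp
  have hnonneg (i : Fin n) : 0 ≤ Real.logb 2 (multiplicity D (D i)) :=
    Real.logb_nonneg one_lt_two (mod_cast multiplicity_apply_pos D i)
  have hgroup := ENNReal.ofReal_le_ofReal (multiplicity_mul_logb_le hD P)
  rw [ENNReal.ofReal_add (mul_nonneg (Nat.cast_nonneg _) (logb_card_destinations_nonneg _ _ _ _))
    (Finset.sum_nonneg fun i _ => hnonneg i), ENNReal.ofReal_sum_of_nonneg fun i _ => hnonneg i,
    ENNReal.ofReal_mul (Nat.cast_nonneg _), ENNReal.ofReal_mul (Nat.cast_nonneg _),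
    ENNReal.ofReal_natCast] at hgroup
  have hconst (F : Plane → ℝ≥0∞) : ∑ i with C i = P, F (C i) = multiplicity C P * F P := by
    rw [multiplicity_eq_card_filter, ← nsmul_eq_mul]
    exact Finset.sum_eq_card_nsmul fun i hi => congrArg F ((Finset.mem_filter_univ i).1 hi)
  rw [Finset.sum_add_distrib, hconst fun Q => ENNReal.ofReal (Real.logb 2 (multiplicity C Q)),
    hconst fun Q => if 2 ≤ multiplicity C Q then
      ENNReal.ofReal (Real.logb 2 (A.destinations (φ Q) C Q).card) else 0, if_pos hP]
  exact hgroup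

theorem nLog_le_bits {B : Algorithm} (hB : B.IsScattering) (n : ℕ) :
    ENNReal.ofReal (nLog n) ≤ B.bits n := by
  rw [← entropy_const 0]
  refine le_trans ?_ (expectedTotal_le_bits B default fun _ => 0)
  refine le_expectedTotal_of_submartingale hB ENNReal.ofReal_ne_top entropy_le_nLog
    (fun C hC => hC.entropy_eq_zero) fun h _ => ?_
  rw [← mean_const (B.step ((default : Adversary n) h) h.1) (entropy h.1),
    ← mean_const (B.step ((default : Adversary n) h) h.1) (B.roundBits _ _), ← mean_add]
  exact mean_mono fun D hD => entropy_le_roundBits_add_entropy hD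

end RandomBitLowerBound

section TimeLowerBound

variable {n n' : ℕ}

/-- Configurations, possibly with different numbers of robots, that robots with global weak
multiplicity detection cannot tell apart. -/
def WeaklyIndistinguishable (C : Config n) (C' : Config n') : Prop :=
  ∀ P, (0 < multiplicity C P ↔ 0 < multiplicity C' P) ∧
    (1 < multiplicity C P ↔ 1 < multiplicity C' P)

theorem Algorithm.GlobalWeakDetection.destinations_eq {B : Algorithm} (hB : B.GlobalWeakDetection)
    {C : Config n} {C' : Config n'} (h : WeaklyIndistinguishable C C') (φ : Frame) (P : Plane) :
    B.destinations φ C P = B.destinations φ C' P := by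
  refine congrArg (Multiset.map (φ.toGlobal P)) (hB _ _ (fun X => ?_) fun X => ?_)
  · simpa only [mem_localSnapshot, multiplicity_pos_iff] using (h (φ.toGlobal P X)).1
  · have hX := (h (φ.toGlobal P X)).2
    rw [← count_localSnapshot, ← count_localSnapshot] at hX
    convert hX

theorem multiplicity_eq_count (C : Config n) (P : Plane) :
    multiplicity C P = (Finset.univ.val.map C).count P := by
  rw [multiplicity_eq_card_filter, Multiset.count_map, Finset.card_def, Finset.filter_val]
  simp only [eq_comm]

theorem exists_config_map_val_eq (T : Multiset Plane) :
    ∃ C : Config T.card, Finset.univ.val.map C = T := by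
  induction T using Quotient.inductionOn with
  | h l => exact ⟨l.get, (Fin.univ_val_map l.get).trans (congrArg _ (List.ofFn_get l))⟩

theorem exists_weaklyIndistinguishable (C : Config n) {P : Plane} (hP : 2 ≤ multiplicity C P)
    (r : ℕ) : ∃ (n' : ℕ) (C' : Config n'), WeaklyIndistinguishable C C' ∧
      n' ≤ 2 * #(occ C) + r ∧ r ≤ multiplicity C' P := by
  set M : Finset Plane := {Q ∈ occ C | 1 < multiplicity C Q} with hM
  obtain ⟨C', hC'⟩ := exists_config_map_val_eq ((occ C).val + M.val + Multiset.replicate r P)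
  have hmult (Q : Plane) : multiplicity C' Q =
      (if Q ∈ occ C then 1 else 0) + (if Q ∈ M then 1 else 0) + if P = Q then r else 0 := by
    rw [multiplicity_eq_count, hC', Multiset.count_add, Multiset.count_add,
      Multiset.count_replicate, Multiset.count_eq_of_nodup (occ C).nodup,
      Multiset.count_eq_of_nodup M.nodup]
    rfl
  refine ⟨_, C', fun Q => ?_, ?_, ?_⟩
  · simp only [hmult Q, hM, Finset.mem_filter, ← multiplicity_pos_iff]
    split_ifs <;> grind
  · have hMcard : #M ≤ #(occ C) := Finset.card_filter_le _ _
    simp only [Multiset.card_add, Finset.card_val, Multiset.card_replicate]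
    omega
  · rw [hmult P, if_pos rfl]
    omega

theorem multiplicity_mul_logb_le_bits (A : Algorithm) (φ : Frame) {C : Config n} {P : Plane}
    (hP : 2 ≤ multiplicity C P) :
    ENNReal.ofReal (multiplicity C P * Real.logb 2 (A.destinations φ C P).card) ≤ A.bits n := by
  have hC : ¬ Scattered C := fun h => by
    have := h.multiplicity_le_one P
    omega
  refine le_trans ?_ (expectedTotal_le_bits A (fun _ _ => φ) C)
  refine le_trans ?_ (le_expectedTotal_first_round hC _)
  rw [ENNReal.ofReal_mul (Nat.cast_nonneg _), ENNReal.ofReal_natCast, ← nsmul_eq_mul]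
  refine le_trans ?_ (Finset.sum_le_sum_of_subset (Finset.filter_subset (C · = P) Finset.univ))
  refine Finset.card_nsmul_le_sum _ _ _ fun i hi => ?_
  obtain rfl := (Finset.mem_filter_univ i).1 hi
  exact (if_pos hP).ge

theorem nLog_mono : Monotone nLog := by
  intro m n hmn
  rcases m.eq_zero_or_pos with rfl | hm
  · rw [nLog, Nat.cast_zero, zero_mul]
    exact mul_nonneg n.cast_nonneg (div_nonneg (Real.log_natCast_nonneg n) (by positivity))
  · have hlog : 0 ≤ Real.logb 2 m := Real.logb_nonneg one_lt_two (mod_cast hm)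
    unfold nLog
    gcongr
    exact one_lt_two

theorem le_pow_of_mul_logb_le {c : ℝ} {k r : ℕ} (hk : 0 < k) (hr : 0 < r)
    (h : r * Real.logb 2 k ≤ c * nLog (2 * r)) : k ≤ (2 * r) ^ ⌈2 * c⌉₊ := by
  have hr' : (0 : ℝ) < r := mod_cast hr
  have hlog : 0 ≤ Real.logb 2 (2 * r : ℕ) := Real.logb_nonneg one_lt_two (mod_cast by omega)
  have hlogb : Real.logb 2 k ≤ Real.logb 2 (((2 * r : ℕ) : ℝ) ^ ⌈2 * c⌉₊) := by
    refine le_of_mul_le_mul_left ?_ hr'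
    calc r * Real.logb 2 k ≤ c * nLog (2 * r) := h
      _ = r * (2 * c * Real.logb 2 (2 * r : ℕ)) := by rw [nLog]; push_cast; ring
      _ ≤ r * (⌈2 * c⌉₊ * Real.logb 2 (2 * r : ℕ)) := by gcongr; exact Nat.le_ceil _
      _ = r * Real.logb 2 (((2 * r : ℕ) : ℝ) ^ ⌈2 * c⌉₊) := by rw [Real.logb_pow]
  exact_mod_cast (Real.logb_le_logb one_lt_two (mod_cast hk) (by positivity)).1 hlogb

-- The robots at `P` would make the same choice in an indistinguishable configuration most of whose
-- robots are at `P`, where a large number of destinations would exceed the bit bound.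
theorem Algorithm.GlobalWeakDetection.card_destinations_le {B : Algorithm}
    (hB : B.GlobalWeakDetection) {c : ℝ} (hc : 0 ≤ c) {n₀ : ℕ}
    (hbits : ∀ m ≥ n₀, B.bits m ≤ ENNReal.ofReal (c * nLog m)) {C : Config n} (φ : Frame)
    {P : Plane} (hP : 2 ≤ multiplicity C P) :
    (B.destinations φ C P).card ≤ ((4 + 2 * n₀) * #(occ C)) ^ ⌈2 * c⌉₊ := by
  have hu : 0 < #(occ C) := Finset.card_pos.2 ⟨P, multiplicity_pos_iff.1 (by omega)⟩
  set r := 2 * #(occ C) + n₀ with hr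
  obtain ⟨n', C', hindist, hn', hrP⟩ := exists_weaklyIndistinguishable C hP r
  have hrn' : r ≤ n' := hrP.trans (multiplicity_le C' P)
  have hlog := logb_card_destinations_nonneg B φ C' P
  have hreal : r * Real.logb 2 (B.destinations φ C' P).card ≤ c * nLog (2 * r) := by
    have hnLog : 0 ≤ nLog (2 * r) := by simpa [nLog] using nLog_mono (Nat.zero_le (2 * r))
    refine (ENNReal.ofReal_le_ofReal_iff (by positivity)).1 ?_
    calc ENNReal.ofReal (r * Real.logb 2 (B.destinations φ C' P).card)
        ≤ ENNReal.ofReal (multiplicity C' P * Real.logb 2 (B.destinations φ C' P).card) := by gcongr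
      _ ≤ B.bits n' := multiplicity_mul_logb_le_bits B φ ((hindist P).2.1 hP)
      _ ≤ ENNReal.ofReal (c * nLog n') := hbits n' (by omega)
      _ ≤ ENNReal.ofReal (c * nLog (2 * r)) := by gcongr; exact nLog_mono (by omega)
  rw [hB.destinations_eq hindist φ P]
  refine (le_pow_of_mul_logb_le (card_destinations_pos _ _ _ _) (by omega) hreal).trans ?_
  refine Nat.pow_le_pow_left ?_ _
  rw [hr]
  nlinarith

theorem card_occ_step_le {B : Algorithm} {φ : Plane → Frame} {C D : Config n}
    (hD : D ∈ (B.step φ C).support) {K : ℕ} (hK : 0 < K)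
    (hC : ∀ P, 2 ≤ multiplicity C P → (B.destinations (φ P) C P).card ≤ K) :
    #(occ D) ≤ #(occ C) * K := by
  have hcover : occ D ⊆ (occ C).biUnion fun P => Finset.image D {i | C i = P} := fun Q hQ => by
    obtain ⟨i, rfl⟩ := mem_occ.1 hQ
    exact Finset.mem_biUnion.2 ⟨C i, apply_mem_occ C i,
      Finset.mem_image_of_mem D ((Finset.mem_filter_univ i).2 rfl)⟩
  refine (Finset.card_le_card hcover).trans (Finset.card_biUnion_le_card_mul _ _ _ fun P _ => ?_)
  rcases lt_or_ge (multiplicity C P) 2 with hP | hP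
  · exact Finset.card_image_le.trans (Nat.le_of_lt_succ (hP.trans_le (Nat.succ_le_succ hK)))
  · exact (card_image_filter_eq_le_card_destinations hD P).trans (hC P hP)

theorem mul_card_occ_execution_le {B : Algorithm} {E d : ℕ} (hE : 0 < E) (hn : 0 < n)
    (hB : ∀ (φ : Frame) (C : Config n) (P : Plane), 2 ≤ multiplicity C P →
      (B.destinations φ C P).card ≤ (E * #(occ C)) ^ d)
    {adv : Adversary n} {P : Plane} {t : ℕ} {h : History n}
    (hh : h ∈ (B.execution adv (fun _ => P) t).support) :
    ∀ C ∈ h.1 :: h.2, E * #(occ C) ≤ E ^ (d + 1) ^ t := by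
  induction t generalizing h with
  | zero =>
    obtain rfl := (PMF.mem_support_pure_iff _ _).1 hh
    have hocc : #(occ fun _ : Fin n => P) ≤ 1 := Finset.card_le_one.2 fun Q hQ R hR => by
      obtain ⟨_, rfl⟩ := mem_occ.1 hQ
      obtain ⟨_, rfl⟩ := mem_occ.1 hR
      rfl
    simpa using Nat.mul_le_mul_left E hocc
  | succ t ih =>
    obtain ⟨g, hg, hh⟩ := (PMF.mem_support_bind_iff _ _ _).1 hh
    obtain ⟨D, hD, rfl⟩ := (PMF.mem_support_map_iff _ _ _).1 hh
    refine List.forall_mem_cons.2 ⟨?_, fun C hC => (ih hg C hC).trans ?_⟩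
    · have hpos : 0 < E * #(occ g.1) := Nat.mul_pos hE (card_occ_pos hn _)
      calc E * #(occ D) ≤ E * (#(occ g.1) * (E * #(occ g.1)) ^ d) := by
            gcongr
            exact card_occ_step_le hD (pow_pos hpos d) fun Q => hB (adv g Q) g.1 Q
        _ = (E * #(occ g.1)) ^ (d + 1) := by ring
        _ ≤ (E ^ (d + 1) ^ t) ^ (d + 1) := by gcongr; exact ih hg g.1 List.mem_cons_self
        _ = E ^ (d + 1) ^ (t + 1) := by rw [← pow_mul, ← pow_succ]
    · gcongr <;> omega

theorem logLog_le_of_le_two_pow_two_pow {n a : ℕ} (h : n ≤ 2 ^ 2 ^ a) : logLog n ≤ a := by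
  rcases lt_or_ge n 2 with hn | hn
  · interval_cases n <;> simp [logLog]
  have hn' : (1 : ℝ) < n := mod_cast hn
  rw [logLog, Real.logb_le_iff_le_rpow one_lt_two (Real.logb_pos one_lt_two hn'),
    Real.logb_le_iff_le_rpow one_lt_two (by positivity), Real.rpow_natCast]
  exact_mod_cast h

theorem pow_pow_le_two_pow_two_pow (E q t : ℕ) : E ^ q ^ t ≤ 2 ^ 2 ^ (E + q * t) := by
  calc E ^ q ^ t ≤ (2 ^ E) ^ q ^ t := by gcongr; exact Nat.lt_two_pow_self.le
    _ = 2 ^ (E * q ^ t) := by rw [pow_mul]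
    _ ≤ 2 ^ (2 ^ E * (2 ^ q) ^ t) := by gcongr <;> first | omega | exact Nat.lt_two_pow_self.le
    _ = 2 ^ 2 ^ (E + q * t) := by rw [← pow_mul, ← pow_add]

theorem logLog_sub_div_le_rounds {B : Algorithm} {E d : ℕ} (hE : 0 < E) (hn : 0 < n)
    (hB : ∀ (φ : Frame) (C : Config n) (P : Plane), 2 ≤ multiplicity C P →
      (B.destinations φ C P).card ≤ (E * #(occ C)) ^ d) :
    ENNReal.ofReal ((logLog n - E) / (d + 1)) ≤ B.rounds n := by
  calc ENNReal.ofReal ((logLog n - E) / (d + 1))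
      ≤ (⌈(logLog n - E) / (d + 1)⌉₊ : ℝ≥0∞) := by
        rw [← ENNReal.ofReal_natCast]
        exact ENNReal.ofReal_le_ofReal (Nat.le_ceil _)
    _ ≤ B.rounds n := by
        refine le_rounds_of_unscattered (adv := default) (C₀ := fun _ => 0) fun t ht h hh => ?_
        suffices hunscattered : ∀ C ∈ h.1 :: h.2, ¬ Scattered C from
          List.forall_mem_cons.1 hunscattered
        refine fun C hC hscattered => ht.not_ge (Nat.ceil_le.2 ?_)
        have hpow : n ≤ 2 ^ 2 ^ (E + (d + 1) * t) :=
          calc n ≤ E * #(occ C) := by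
                rw [scattered_iff_card_occ_eq.1 hscattered]
                exact Nat.le_mul_of_pos_left n hE
            _ ≤ E ^ (d + 1) ^ t := mul_card_occ_execution_le hE hn hB hh C hC
            _ ≤ 2 ^ 2 ^ (E + (d + 1) * t) := pow_pow_le_two_pow_two_pow E (d + 1) t
        have hlog := logLog_le_of_le_two_pow_two_pow hpow
        push_cast at hlog
        rw [div_le_iff₀ (by positivity)]
        linarith

theorem tendsto_logLog_atTop : Tendsto logLog atTop atTop := by
  have hlogb := Real.tendsto_logb_atTop one_lt_two
  exact hlogb.comp (hlogb.comp tendsto_natCast_atTop_atTop)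

theorem Algorithm.GlobalWeakDetection.isBigOmega_rounds {B : Algorithm}
    (hB : B.GlobalWeakDetection) (hbits : IsBigO B.bits nLog) : IsBigOmega B.rounds logLog := by
  obtain ⟨c, hc, hbits⟩ := hbits
  obtain ⟨n₀, hn₀⟩ := eventually_atTop.1 hbits
  set d := ⌈2 * c⌉₊
  set E := 4 + 2 * n₀
  refine ⟨1 / (2 * (d + 1)), by positivity, ?_⟩
  filter_upwards [tendsto_logLog_atTop.eventually_ge_atTop (2 * E), eventually_gt_atTop 0]
    with n hlog hn
  refine le_trans (ENNReal.ofReal_le_ofReal ?_) (logLog_sub_div_le_rounds (by omega) hn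
    fun φ C P => hB.card_destinations_le hc.le hn₀ φ)
  rw [div_mul_eq_mul_div, div_le_div_iff₀ (by positivity) (by positivity)]
  nlinarith

end TimeLowerBound

section Coincidences

theorem card_coincidence_mul_le {ι β : Type*} [Fintype ι] [DecidableEq ι] [DecidableEq β]
    {α : ι → Type*} [∀ i, Fintype (α i)] (val : ∀ i, α i → β) {i j : ι}
    (hval : Function.Injective (val j)) (hij : i ≠ j) :
    #{c : ∀ i, α i | val i (c i) = val j (c j)} * Fintype.card (α j)
      ≤ Fintype.card (∀ i, α i) := by
  rw [← Finset.card_univ (α := α j), ← Finset.card_product]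
  -- The choice of `i` determines the choice of `j`, which is thus free to be replaced.
  refine Finset.card_le_card_of_injOn (fun p => Function.update p.1 j p.2)
    (fun _ _ => Finset.mem_univ _) ?_
  rintro ⟨c, a⟩ hc ⟨c', a'⟩ hc' h
  replace hc : val i (c i) = val j (c j) := by simpa using hc
  replace hc' : val i (c' i) = val j (c' j) := by simpa using hc'
  have hne : ∀ l ≠ j, c l = c' l := fun l hl => by
    simpa [Function.update_of_ne hl] using congrFun h l
  have hj : c j = c' j := hval (by rw [← hc, ← hc', hne i hij])
  refine Prod.ext (funext fun l => ?_) (by simpa using congrFun h j)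
  rcases eq_or_ne l j with rfl | hl
  exacts [hj, hne l hl]

theorem coe_toType_injective {β : Type*} [DecidableEq β] {s : Multiset β} (hs : s.Nodup) :
    Function.Injective fun a : s.ToType => a.1 := by
  rintro ⟨a, k⟩ ⟨b, l⟩ (rfl : a = b)
  have hcount := Multiset.nodup_iff_count_le_one.1 hs a
  obtain rfl : k = l := Fin.ext (by omega)
  rfl

variable {n : ℕ} {A : Algorithm} {φ : Plane → Frame} {C : Config n}

theorem toOuterMeasure_step_coincidence_le {i j : Fin n} (hij : i ≠ j)
    (hj : (A.destinations (φ (C j)) C (C j)).Nodup) :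
    (A.step φ C).toOuterMeasure {D | D i = D j} ≤
      ((A.destinations (φ (C j)) C (C j)).card : ℝ≥0∞)⁻¹ := by
  classical
  have hcard := card_coincidence_mul_le
    (fun (i : Fin n) (a : (A.destinations (φ (C i)) C (C i)).ToType) => a.1)
    (coe_toType_injective hj) hij
  have := A.nonempty_choices φ C
  rw [Algorithm.step, PMF.toOuterMeasure_map_apply, PMF.toOuterMeasure_uniformOfFintype_apply,
    Fintype.card_subtype]
  refine ENNReal.div_le_of_le_mul ?_
  have hpos := card_destinations_pos A (φ (C j)) C (C j)
  rw [← ENNReal.div_eq_inv_mul, ENNReal.le_div_iff_mul_le (Or.inl (by simpa using hpos.ne'))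
    (Or.inl (ENNReal.natCast_ne_top _))]
  rw [Multiset.card_coe] at hcard
  norm_cast
  convert hcard
  exact Iff.rfl

theorem toOuterMeasure_step_not_injOn_le {K : ℕ} (R : Finset (Fin n))
    (hnodup : ∀ i ∈ R, (A.destinations (φ (C i)) C (C i)).Nodup)
    (hK : ∀ i ∈ R, K ≤ (A.destinations (φ (C i)) C (C i)).card) :
    (A.step φ C).toOuterMeasure {D | ¬ Set.InjOn D R} ≤ #R.offDiag / K := by
  have hcover : {D : Config n | ¬ Set.InjOn D R} ⊆ ⋃ p ∈ R.offDiag, {D | D p.1 = D p.2} := by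
    intro D hD
    obtain ⟨i, hi, j, hj, hD, hij⟩ : ∃ i ∈ R, ∃ j ∈ R, D i = D j ∧ i ≠ j := by
      simpa [Set.InjOn] using hD
    exact Set.mem_biUnion (Finset.mem_offDiag.2 ⟨hi, hj, hij⟩ : (i, j) ∈ R.offDiag) hD
  calc (A.step φ C).toOuterMeasure {D | ¬ Set.InjOn D R}
      ≤ ∑ p ∈ R.offDiag, (A.step φ C).toOuterMeasure {D | D p.1 = D p.2} :=
        (MeasureTheory.measure_mono hcover).trans (MeasureTheory.measure_biUnion_finset_le _ _)
    _ ≤ ∑ _p ∈ R.offDiag, (K : ℝ≥0∞)⁻¹ := Finset.sum_le_sum fun p hp => by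
        obtain ⟨-, hj, hij⟩ := Finset.mem_offDiag.1 hp
        refine (toOuterMeasure_step_coincidence_le hij (hnodup _ hj)).trans ?_
        gcongr
        exact hK _ hj
    _ = #R.offDiag / K := by rw [Finset.sum_const, nsmul_eq_mul, div_eq_mul_inv]

end Coincidences

section Implementations

variable {n : ℕ} {A : Algorithm} {f : ℕ → ℕ} {N : ℕ} {C D : Config n} {P Q : Plane}

theorem Algorithm.NoDetection.globalWeakDetection (hA : A.NoDetection) : A.GlobalWeakDetection :=
  fun S S' hS _ => hA S S' hS

theorem Algorithm.IsSA.card_destinations (hA : A.IsSA f N) (φ : Frame) (hP : P ∈ occ C) :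
    (A.destinations φ C P).card = saCount f N #(occ C) := by
  rw [Scattering.card_destinations, hA.card_dest _ (zero_mem_localSnapshot hP),
    ← card_toFinset_localSnapshot]

theorem Algorithm.IsSA.nodup_destinations (hA : A.IsSA f N) (φ : Frame) (hP : P ∈ occ C) :
    (A.destinations φ C P).Nodup :=
  (hA.nodup _ (zero_mem_localSnapshot hP)).map (φ.toGlobal_injective P)

theorem Algorithm.IsSA.mem_voronoiCell (hA : A.IsSA f N) {φ : Frame} (hP : P ∈ occ C)
    (hQ : Q ∈ A.destinations φ C P) : Q ∈ voronoiCell (occ C) P := by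
  obtain ⟨X, hX, rfl⟩ := Multiset.mem_map.1 hQ
  intro P' hP' hne
  have hlocal : dist X 0 < dist X (φ.toLocal P P') :=
    hA.mem_cell _ (zero_mem_localSnapshot hP) X hX _
      (mem_localSnapshot.2 (by rwa [φ.toGlobal_toLocal]))
      (by rw [← φ.toLocal_self P]; exact (φ.toLocal_injective P).ne hne)
  rw [← φ.toLocal_self P, ← φ.toLocal_toGlobal P X, φ.dist_toLocal, φ.dist_toLocal] at hlocal
  exact lt_of_mul_lt_mul_left hlocal φ.scale_pos.le

-- Robots at distinct locations stay in disjoint Voronoi cells.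
theorem Algorithm.IsSA.step_ne (hA : A.IsSA f N) {φ : Plane → Frame}
    (hD : D ∈ (A.step φ C).support) {i j : Fin n} (hij : C i ≠ C j) : D i ≠ D j := by
  intro h
  have hcell (l : Fin n) : D l ∈ voronoiCell (occ C) (C l) :=
    hA.mem_voronoiCell (apply_mem_occ C l) (mem_destinations_of_mem_support_step hD l)
  have hi := hcell i (C j) (apply_mem_occ C j) hij.symm
  have hj := hcell j (C i) (apply_mem_occ C i) hij
  rw [h] at hi
  exact lt_asymm hi hj

theorem Algorithm.IsSA.card_occ_le_step (hA : A.IsSA f N) {φ : Plane → Frame}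
    (hD : D ∈ (A.step φ C).support) : #(occ C) ≤ #(occ D) := by
  have hfactor : C.FactorsThrough D := fun i j h => by_contra fun hne => hA.step_ne hD hne h
  obtain ⟨g, hg⟩ := (Function.factorsThrough_iff C).1 hfactor
  have himage : occ C = (occ D).image g := by
    simp only [occ, Finset.image_image, ← hg]
  exact himage ▸ Finset.card_image_le

theorem apply_maxInv (hmono : Monotone f) (hsurj : Function.Surjective f) (y : ℕ) :
    f (maxInv f y) = y := by
  obtain ⟨z, hz⟩ := hsurj (y + 1)
  refine Nat.sSup_mem (s := {x | f x = y}) (hsurj y) ⟨z, fun x (hx : f x = y) => ?_⟩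
  by_contra! hlt
  have := hmono hlt.le
  omega

end Implementations

section Levels

variable {n : ℕ} {A : Algorithm} {f : ℕ → ℕ} {N : ℕ} {C D : Config n}

open Classical in
/-- The progress made by `SA_f`: the value of `f` at the number of occupied points, and one more
than the largest such value once the robots are scattered. -/
noncomputable def level (f : ℕ → ℕ) (C : Config n) : ℕ :=
  if Scattered C then f n + 1 else f #(occ C)

theorem level_of_not_scattered (hC : ¬ Scattered C) : level f C = f #(occ C) := if_neg hC

theorem apply_card_occ_le_level (f : ℕ → ℕ) (C : Config n) : f #(occ C) ≤ level f C := by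
  unfold level
  split_ifs with hC
  · rw [scattered_iff_card_occ_eq.1 hC]
    exact Nat.le_succ _
  · exact le_rfl

theorem level_le_of_not_scattered (hmono : Monotone f) (hC : ¬ Scattered C) : level f C ≤ f n :=
  (level_of_not_scattered hC).trans_le (hmono (card_occ_le C))

theorem Algorithm.IsSA.level_le_step (hA : A.IsSA f N) (hmono : Monotone f) {φ : Plane → Frame}
    (hC : ¬ Scattered C) (hD : D ∈ (A.step φ C).support) : level f C ≤ level f D := by
  rw [level_of_not_scattered hC]
  exact (hmono (hA.card_occ_le_step hD)).trans (apply_card_occ_le_level f D)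

theorem level_lt_of_injOn (hmono : Monotone f) (hsurj : Function.Surjective f)
    (hC : ¬ Scattered C) {R : Finset (Fin n)} (hR : #R = min n (maxInv f (f #(occ C) + 1)))
    (hD : Set.InjOn D R) : level f C < level f D := by
  have hRD : #R ≤ #(occ D) := by
    rw [← Finset.card_image_of_injOn hD]
    exact Finset.card_le_card (Finset.image_subset_image (Finset.subset_univ R))
  by_cases hscattered : Scattered D
  · rw [level, level, if_pos hscattered, if_neg hC]
    exact Nat.lt_succ_of_le (hmono (card_occ_le C))
  · have hlt : #(occ D) < n :=
      (card_occ_le D).lt_of_ne (mt scattered_iff_card_occ_eq.2 hscattered)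
    rw [level_of_not_scattered hC, level_of_not_scattered hscattered, ← Nat.succ_le_iff,
      ← apply_maxInv hmono hsurj (f #(occ C)).succ]
    exact hmono (by simp only [Nat.succ_eq_add_one]; omega)

-- A birthday bound: `maxInv f (f u + 1)` robots would raise the level if their destinations were
-- distinct, and the number of pairs of them is small compared with the number of destinations.
theorem Algorithm.IsSA.toOuterMeasure_level_le (hA : A.IsSA f N) (hmono : Monotone f)
    (hsurj : Function.Surjective f) (φ : Plane → Frame) (hC : ¬ Scattered C) :
    (A.step φ C).toOuterMeasure {D | level f D ≤ level f C} ≤ 2⁻¹ := by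
  set x := maxInv f (f #(occ C) + 1)
  set K := saCount f N #(occ C)
  obtain ⟨R, -, hR⟩ := Finset.exists_subset_card_eq
    ((min_le_left n x).trans_eq (Finset.card_fin n).symm)
  have hpairs : 2 * #R.offDiag ≤ K :=
    calc 2 * #R.offDiag ≤ 2 * #R ^ 2 := by
          rw [Finset.offDiag_card, sq]
          exact Nat.mul_le_mul_left 2 (Nat.sub_le _ _)
      _ ≤ 2 * x ^ 2 := by gcongr; exact hR.trans_le (min_le_right n x)
      _ ≤ 2 * x ^ 4 := by
          rcases x.eq_zero_or_pos with h | h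
          · simp [h]
          · gcongr; omega
      _ ≤ 16 * x ^ 4 := by omega
      _ ≤ K := (le_max_left _ _).trans (le_max_right _ _)
  calc (A.step φ C).toOuterMeasure {D | level f D ≤ level f C}
      ≤ (A.step φ C).toOuterMeasure {D | ¬ Set.InjOn D R} :=
        MeasureTheory.measure_mono fun D (hD : level f D ≤ level f C) hinj =>
          hD.not_gt (level_lt_of_injOn hmono hsurj hC hR hinj)
    _ ≤ #R.offDiag / K := toOuterMeasure_step_not_injOn_le R
        (fun i _ => hA.nodup_destinations _ (apply_mem_occ C i))
        fun i _ => (hA.card_destinations _ (apply_mem_occ C i)).ge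
    _ ≤ 2⁻¹ := by
        refine ENNReal.div_le_of_le_mul ?_
        rw [← ENNReal.div_eq_inv_mul, ENNReal.le_div_iff_mul_le (by simp) (by simp), mul_comm]
        exact_mod_cast hpairs

theorem Algorithm.IsSA.expectedTotal_le (hA : A.IsSA f N) (hmono : Monotone f)
    (hsurj : Function.Surjective f) (adv : Adversary n) (C₀ : Config n) {w : History n → ℝ≥0∞}
    {g : ℕ → ℝ≥0∞} (hw : ∀ h : History n, ¬ Scattered h.1 → w h ≤ g (level f h.1)) :
    A.expectedTotal adv C₀ w ≤ 2 * ∑ y ∈ Finset.range (f n + 1), g y := by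
  let V (C : Config n) : ℝ≥0∞ := 2 * ∑ y ∈ Finset.Icc (level f C) (f n), g y
  suffices hV : ∀ h : History n, ¬ Scattered h.1 →
      w h + mean (A.step (adv h) h.1) V ≤ V h.1 by
    refine (expectedTotal_le_of_supermartingale hV).trans (mul_le_mul_right ?_ 2)
    exact Finset.sum_le_sum_of_subset fun y hy =>
      Finset.mem_range.2 (Nat.lt_succ_of_le (Finset.mem_Icc.1 hy).2)
  intro h hs
  set l := level f h.1
  set b := 2 * ∑ y ∈ Finset.Ioc l (f n), g y with hb
  have hVl : V h.1 = b + 2 * g l := by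
    rw [hb, ← mul_add, Finset.sum_Ioc_add_eq_sum_Icc (level_le_of_not_scattered hmono hs)]
  have hstep : ∀ D ∈ (A.step (adv h) h.1).support,
      V D ≤ b + {D | level f D ≤ l}.indicator (fun _ => 2 * g l) D := by
    intro D hD
    by_cases hDl : level f D ≤ l
    · rw [Set.indicator_of_mem (show D ∈ {D | level f D ≤ l} from hDl), ← hVl]
      have : l ≤ level f D := hA.level_le_step hmono hs hD
      dsimp only [V]
      gcongr
    · rw [Set.indicator_of_notMem (show D ∉ {D | level f D ≤ l} from hDl), add_zero]
      refine mul_le_mul_right (Finset.sum_le_sum_of_subset fun y hy => ?_) 2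
      rw [Finset.mem_Icc] at hy
      exact Finset.mem_Ioc.2 ⟨by omega, hy.2⟩
  calc w h + mean (A.step (adv h) h.1) V
      ≤ g l + (b + 2 * g l * (A.step (adv h) h.1).toOuterMeasure {D | level f D ≤ l}) := by
        refine add_le_add (hw h hs) ((mean_mono hstep).trans_eq ?_)
        rw [mean_add, mean_const, mean_indicator_const]
    _ ≤ g l + (b + 2 * g l * 2⁻¹) := by
        gcongr
        exact hA.toOuterMeasure_level_le hmono hsurj (adv h) hs
    _ = V h.1 := by
        rw [hVl, mul_right_comm, ENNReal.mul_inv_cancel two_ne_zero ENNReal.ofNat_ne_top, one_mul,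
          two_mul, add_left_comm]

end Levels

section LogLog

theorem logLogNat_mono : Monotone logLogNat :=
  fun _ _ h => Nat.log_mono_right (Nat.log_mono_right h)

theorem logLogNat_two_pow_two_pow (y : ℕ) : logLogNat (2 ^ 2 ^ y) = y := by
  rw [logLogNat, Nat.log_pow one_lt_two, Nat.log_pow one_lt_two]

theorem logLogNat_surjective : Function.Surjective logLogNat :=
  fun y => ⟨_, logLogNat_two_pow_two_pow y⟩

theorem lt_two_pow_two_pow_logLogNat (x : ℕ) : x < 2 ^ 2 ^ (logLogNat x + 1) :=
  (Nat.lt_pow_succ_log_self one_lt_two x).trans_le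
    (Nat.pow_le_pow_right two_pos (Nat.lt_pow_succ_log_self one_lt_two _))

theorem two_pow_logLogNat_le_logb {n : ℕ} (hn : 4 ≤ n) :
    (2 : ℝ) ^ logLogNat n ≤ Real.logb 2 n := by
  have hlog : Nat.log 2 n ≠ 0 := (Nat.log_pos one_lt_two (by omega)).ne'
  calc (2 : ℝ) ^ logLogNat n ≤ (Nat.log 2 n : ℕ) := mod_cast Nat.pow_log_le_self 2 hlog
    _ ≤ Real.logb 2 n := Real.natLog_le_logb n 2

theorem logLogNat_le_logLog {n : ℕ} (hn : 4 ≤ n) : logLogNat n ≤ logLog n := by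
  have hpow := two_pow_logLogNat_le_logb hn
  rwa [logLog, Real.le_logb_iff_rpow_le one_lt_two (hpow.trans_lt' (by positivity)),
    Real.rpow_natCast]

theorem saCount_logLogNat_le (N u : ℕ) :
    saCount logLogNat N u ≤ 2 ^ ((8 * N ^ 3 + 20) * 2 ^ logLogNat u) := by
  set y := logLogNat u
  have : 1 ≤ 2 ^ y := Nat.one_le_two_pow
  refine max_le ?_ (max_le ?_ ?_)
  · calc 8 * N ^ 3 ≤ 2 ^ (8 * N ^ 3) := Nat.lt_two_pow_self.le
      _ ≤ 2 ^ ((8 * N ^ 3 + 20) * 2 ^ y) :=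
        Nat.pow_le_pow_right two_pos (by nlinarith [(N ^ 3).zero_le])
  · have hmaxInv := lt_two_pow_two_pow_logLogNat (maxInv logLogNat (y + 1))
    rw [apply_maxInv logLogNat_mono logLogNat_surjective] at hmaxInv
    calc 16 * maxInv logLogNat (y + 1) ^ 4 ≤ 2 ^ 4 * (2 ^ 2 ^ (y + 1 + 1)) ^ 4 := by
          gcongr; norm_num
      _ = 2 ^ (4 + 16 * 2 ^ y) := by rw [← pow_mul, ← pow_add]; congr 1; ring
      _ ≤ 2 ^ ((8 * N ^ 3 + 20) * 2 ^ y) :=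
        Nat.pow_le_pow_right two_pos (by nlinarith [(N ^ 3).zero_le])
  · calc u ^ 3 ≤ (2 ^ 2 ^ (y + 1)) ^ 3 := by gcongr; exact (lt_two_pow_two_pow_logLogNat u).le
      _ = 2 ^ (6 * 2 ^ y) := by rw [← pow_mul]; congr 1; ring
      _ ≤ 2 ^ ((8 * N ^ 3 + 20) * 2 ^ y) :=
        Nat.pow_le_pow_right two_pos (by nlinarith [(N ^ 3).zero_le])

end LogLog

section UpperBounds

variable {n : ℕ} {A : Algorithm} {f : ℕ → ℕ} {N : ℕ}

theorem Algorithm.IsSA.rounds_le (hA : A.IsSA f N) (hmono : Monotone f)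
    (hsurj : Function.Surjective f) (n : ℕ) : A.rounds n ≤ (2 * (f n + 1) : ℕ) :=
  iSup₂_le fun adv C₀ =>
    (hA.expectedTotal_le hmono hsurj adv C₀ (g := fun _ => 1) fun _ _ => le_rfl).trans (by simp)

theorem Algorithm.IsSA.isScattering (hA : A.IsSA f N) (hmono : Monotone f)
    (hsurj : Function.Surjective f) : A.IsScattering :=
  isScattering_of_rounds_ne_top fun n =>
    ne_top_of_le_ne_top (ENNReal.natCast_ne_top _) (hA.rounds_le hmono hsurj n)

theorem Algorithm.IsSA.roundBits_le (hA : A.IsSA logLogNat N) (φ : Plane → Frame) (C : Config n) :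
    A.roundBits φ C ≤ (n * ((8 * N ^ 3 + 20) * 2 ^ logLogNat #(occ C)) : ℕ) := by
  rw [Nat.cast_mul, ← nsmul_eq_mul]
  refine (Finset.sum_le_card_nsmul _ _ _ fun i _ => ?_).trans_eq (by rw [Finset.card_fin])
  split_ifs
  · rw [← ENNReal.ofReal_natCast]
    refine ENNReal.ofReal_le_ofReal ?_
    rw [Real.logb_le_iff_le_rpow one_lt_two (mod_cast card_destinations_pos A _ C _),
      Real.rpow_natCast, hA.card_destinations _ (apply_mem_occ C i)]
    exact_mod_cast saCount_logLogNat_le N _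
  · exact zero_le

theorem Algorithm.IsSA.bits_le (hA : A.IsSA logLogNat N) (n : ℕ) :
    A.bits n ≤ (4 * (8 * N ^ 3 + 20) * (n * 2 ^ logLogNat n) : ℕ) := by
  have hgeom : ∑ y ∈ Finset.range (logLogNat n + 1), 2 ^ y ≤ 2 ^ logLogNat n * 2 :=
    (Nat.geomSum_lt le_rfl fun y => Finset.mem_range.1).le
  refine iSup₂_le fun adv C₀ => ?_
  calc A.expectedTotal adv C₀ (fun h => A.roundBits (adv h) h.1)
      ≤ 2 * ∑ y ∈ Finset.range (logLogNat n + 1), ((n * ((8 * N ^ 3 + 20) * 2 ^ y) : ℕ) : ℝ≥0∞) :=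
        hA.expectedTotal_le logLogNat_mono logLogNat_surjective adv C₀
          (w := fun h => A.roundBits (adv h) h.1)
          (g := fun y => (n * ((8 * N ^ 3 + 20) * 2 ^ y) : ℕ))
          fun h hs => by
            rw [level_of_not_scattered hs]
            exact hA.roundBits_le (adv h) h.1
    _ = (2 * (n * ((8 * N ^ 3 + 20) * ∑ y ∈ Finset.range (logLogNat n + 1), 2 ^ y)) : ℕ) := by
        push_cast
        simp only [Finset.mul_sum]
    _ ≤ (2 * (n * ((8 * N ^ 3 + 20) * (2 ^ logLogNat n * 2))) : ℕ) := by gcongr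
    _ = (4 * (8 * N ^ 3 + 20) * (n * 2 ^ logLogNat n) : ℕ) := by congr 1; ring

theorem Algorithm.IsSA.isBigO_rounds (hA : A.IsSA logLogNat N) : IsBigO A.rounds logLog := by
  refine ⟨4, by norm_num, ?_⟩
  filter_upwards [eventually_ge_atTop 4, tendsto_logLog_atTop.eventually_ge_atTop 1] with n hn hlog
  refine (hA.rounds_le logLogNat_mono logLogNat_surjective n).trans ?_
  rw [← ENNReal.ofReal_natCast]
  refine ENNReal.ofReal_le_ofReal ?_
  have := logLogNat_le_logLog hn
  push_cast
  linarith

theorem Algorithm.IsSA.isBigO_bits (hA : A.IsSA logLogNat N) : IsBigO A.bits nLog := by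
  refine ⟨4 * (8 * N ^ 3 + 20), by positivity, ?_⟩
  filter_upwards [eventually_ge_atTop 4] with n hn
  refine (hA.bits_le n).trans ?_
  rw [← ENNReal.ofReal_natCast]
  refine ENNReal.ofReal_le_ofReal ?_
  push_cast
  rw [nLog]
  gcongr
  exact two_pow_logLogNat_le_logb hn

theorem Algorithm.IsScattering.isBigOmega_bits {B : Algorithm} (hB : B.IsScattering) :
    IsBigOmega B.bits nLog :=
  ⟨1, one_pos, .of_forall fun n => (one_mul (nLog n)).symm ▸ nLog_le_bits hB n⟩

end UpperBounds

section Existence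

theorem voronoiCell_mem_nhds {U : Set Plane} (hU : U.Finite) (P : Plane) :
    voronoiCell U P ∈ 𝓝 P := by
  refine (Filter.eventually_all_finite hU).2 fun P' _ => ?_
  by_cases hne : P' = P
  · exact .of_forall fun _ h => absurd hne h
  · have hcont (R : Plane) : ContinuousAt (fun Q => dist Q R) P := by fun_prop
    refine ((hcont P).eventually_lt (hcont P') ?_).mono fun _ hQ _ => hQ
    rw [dist_self]
    exact dist_pos.2 (Ne.symm hne)

theorem exists_finset_subset_voronoiCell (U : Finset Plane) (P : Plane) (k : ℕ) :
    ∃ t : Finset Plane, (t : Set Plane) ⊆ voronoiCell U P ∧ #t = k := by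
  have : NeBot (𝓝[≠] P) := Module.punctured_nhds_neBot ℝ Plane P
  exact (infinite_of_mem_nhds P (voronoiCell_mem_nhds U.finite_toSet P)).exists_subset_card_eq k

theorem saCount_pos (f : ℕ → ℕ) (N : ℕ) {u : ℕ} (hu : 0 < u) : 0 < saCount f N u :=
  (pow_pos hu 3).trans_le ((le_max_right _ _).trans (le_max_right _ _))

theorem exists_isSA (f : ℕ → ℕ) (N : ℕ) : ∃ A : Algorithm, A.IsSA f N := by
  classical
  choose t ht hcard using fun U : Finset Plane =>
    exists_finset_subset_voronoiCell U 0 (saCount f N #U)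
  let dest (S : Multiset Plane) : Multiset Plane := if 0 ∈ S then (t S.toFinset).val else {0}
  have hdest {S : Multiset Plane} (hS : 0 ∈ S) : dest S = (t S.toFinset).val := if_pos hS
  have hne (S : Multiset Plane) : dest S ≠ 0 := by
    by_cases hS : 0 ∈ S
    · rw [hdest hS, ← Multiset.card_pos, Finset.card_val, hcard]
      exact saCount_pos f N (Finset.card_pos.2 ⟨0, Multiset.mem_toFinset.2 hS⟩)
    · simp [dest, hS]
  refine ⟨⟨dest, hne⟩, fun S S' h => ?_, fun S hS => ?_, fun S hS => ?_, fun S hS Q hQ => ?_⟩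
  · have htoFinset : S.toFinset = S'.toFinset := by
      ext Q
      simpa using h Q
    simp only [dest, h 0, htoFinset]
  · dsimp only
    rw [hdest hS]
    exact (t S.toFinset).nodup
  · dsimp only
    rw [hdest hS, Finset.card_val, hcard]
  · dsimp only at hQ
    rw [hdest hS] at hQ
    simpa [voronoiCell] using ht S.toFinset hQ

end Existence

end Scattering

theorem mainTheorem9_general :
    (∃ N : ℕ, Scattering.IsThreshold N) ∧
    (∀ (f : ℕ → ℕ) (N : ℕ), ∃ A : Scattering.Algorithm, A.IsSA f N) ∧
    (∀ (N : ℕ) (A : Scattering.Algorithm), A.IsSA Scattering.logLogNat N →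
      A.IsScattering ∧
      Scattering.IsBigTheta A.rounds Scattering.logLog ∧
      Scattering.IsBigTheta A.bits Scattering.nLog) ∧
    (∀ B : Scattering.Algorithm, B.IsScattering →
      ∀ n : ℕ, ENNReal.ofReal (Scattering.nLog n) ≤ B.bits n) ∧
    (∀ B : Scattering.Algorithm, B.GlobalWeakDetection →
      Scattering.IsBigO B.bits Scattering.nLog →
      Scattering.IsBigOmega B.rounds Scattering.logLog) := by
  refine ⟨⟨_, Scattering.isThreshold_eight_mul_twenty_four_pow⟩, Scattering.exists_isSA,
    fun N A hA => ?_, fun B hB => Scattering.nLog_le_bits hB, fun B hB => hB.isBigOmega_rounds⟩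
  have hscattering : A.IsScattering :=
    hA.isScattering Scattering.logLogNat_mono Scattering.logLogNat_surjective
  have hrounds : Scattering.IsBigOmega A.rounds Scattering.logLog :=
    hA.noDetection.globalWeakDetection.isBigOmega_rounds hA.isBigO_bits
  exact ⟨hscattering, ⟨hA.isBigO_rounds, hrounds⟩, hA.isBigO_bits, hscattering.isBigOmega_bits⟩

theorem mainTheorem9 :
    -- the constant used by the algorithm exists
    (∃ N : ℕ, Scattering.IsThreshold N) ∧
    ∀ N : ℕ, Scattering.IsThreshold N →
      -- the algorithm can be implemented
      (∃ A : Scattering.Algorithm, A.IsSA Scattering.logLogNat N) ∧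
      -- every implementation scatters, in `Θ(log log n)` rounds and with `Θ(n log n)` bits
      (∀ A : Scattering.Algorithm, A.IsSA Scattering.logLogNat N →
        A.IsScattering ∧
        Scattering.IsBigTheta A.rounds Scattering.logLog ∧
        Scattering.IsBigTheta A.bits Scattering.nLog) ∧
      -- every scattering algorithm, with any multiplicity detection, uses `n log n` bits
      (∀ B : Scattering.Algorithm, B.IsScattering →
        ∀ n : ℕ, ENNReal.ofReal (Scattering.nLog n) ≤ B.bits n) ∧
      -- random bit optimal algorithms without strong detection need `Ω(log log n)` rounds
      (∀ B : Scattering.Algorithm, B.IsScattering → B.GlobalWeakDetection →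
        Scattering.IsBigO B.bits Scattering.nLog →
        Scattering.IsBigOmega B.rounds Scattering.logLog) := by
  obtain ⟨hN, hexists, hSA, hbits, hrounds⟩ := mainTheorem9_general
  exact ⟨hN, fun N _ => ⟨hexists _ N, hSA N, hbits, fun B _ => hrounds B⟩⟩
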